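/- \textbf{Proposition (Split tori of a Sullivan model).} Let $M=(S(V),d)$ be a minimal Sullivan algebra over $\mathbb{R}$ of strong finite type: $V=\bigoplus_{n>0}V^n$ is a graded real vector space with $\dim V<\infty$, $S(V)$ is the free graded commutative algebra on $V$, and $d$ is a derivation of degree $1$ with $d^2=0$, such that $V$ is the union of an increasing sequence of graded subspaces $V(0)\subseteq V(1)\subseteq\cdots$ with $d(V(0))=0$ and $d(V(k))\subseteq S(V(k-1))$ for $k\ge 1$, and such that $d(M)\subseteq M^+\cdot M^+$, where $M^+=\bigoplus_{n>0}M^n$. Put $Z(M^+)=\{x\in M^+ : dx=0\}$ and $$P(M)=Z(M^+)\big/\bigl(Z(M^+)\cap (M^+)^2\bigr).$$ Let $\operatorname{Aut}M$ be the real group scheme of automorphisms of $M$ as a differential graded algebra, so that $(\operatorname{Aut}M)(R)$ is the group of $R$-linear differential graded algebra automorphisms of $R\otimes M$ for every commutative $\mathbb{R}$-algebra $R$. An $\mathbb{R}$-split torus of dimension $n$ is an algebraic group $T\cong\mathbb{G}_m^n$ over $\mathbb{R}$; an action of $T$ on $M$ is a morphism $T\to\operatorname{Aut}M$ of group schemes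 over $\mathbb{R}$; and the weights of the action on $M$ (or on $P(M)$) are the characters $\alpha\colon T\to\mathbb{G}_m$ for which the space of vectors on which $T$ acts through $\alpha$ is nonzero. Let an $\mathbb{R}$-split torus $T$ act on $M$. Then the following hold. \begin{enumerate} \item[(i)] The weights of $T$ on $M$ are generated multiplicatively by its weights on $P(M)$: every weight on $P(M)$ is a weight on $M$, and every weight on $M$ is a finite (possibly empty) product of weights on $P(M)$. \item[(ii)] The action of $T$ on $M$ is determined by its action on $P(M)$ in the following sense: for every commutative $\mathbb{R}$-algebra $R$, a point of $T(R)$ that acts trivially on $R\otimes P(M)$ acts trivially on $R\otimes M$. In particular, if $T\subseteq\operatorname{Aut}M$ (the action on $M$ is faithful), then the composition $T\subseteq\operatorname{Aut}M\to\operatorname{GL}(P(M))$ is injective, $P(M)$ is finite-dimensional, and $\dim T\le\dim P(M)$. \item[(iii)] If $T\subseteq\operatorname{Aut}M$ and $\dim T=\dim P(M)$, then $T$ is a maximal $\mathbb{R}$-split torus of $\operatorname{Aut}M$. \end{enumerate} Moreover, without reference to a torus: \begin{enumerate} \item[(iv)] If $d$ is quadratic, i.e. $d(V)\subseteq S^2(V)$,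 then $\ker d\cap V=Z(M^+)\cap V$ and the natural map $\ker d\cap V\to P(M)$ is an isomorphism. \end{enumerate} -/

import Mathlib

open scoped TensorProduct

universe u v

namespace SplitTori

noncomputable section

/-! ### Graded algebras with a differential over a commutative ring

A grading is a family `𝒜 : ℕ → Submodule R A`, and `d` is a linear endomorphism of `A`. -/

section Graded

variable {R : Type*} [CommRing R] {A : Type*} [Ring A] [Algebra R A]

/-- The augmentation ideal `A⁺ = ⨁_{n > 0} Aⁿ`. -/
def augIdeal (𝒜 : ℕ → Submodule R A) : Submodule R A :=
  ⨆ n : ℕ, ⨆ _ : 0 < n, 𝒜 n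

/-- `(A⁺)² = A⁺ · A⁺`, the span of the products of two elements of `A⁺`. -/
def decomposables (𝒜 : ℕ → Submodule R A) : Submodule R A :=
  augIdeal 𝒜 * augIdeal 𝒜

/-- `Z(A⁺) = {x ∈ A⁺ | d x = 0}`. -/
def cocycles (𝒜 : ℕ → Submodule R A) (d : A →ₗ[R] A) : Submodule R A :=
  LinearMap.ker d ⊓ augIdeal 𝒜

/-- `Z(A⁺) ∩ (A⁺)²`, as a submodule of `Z(A⁺)`. -/
def decCocycles (𝒜 : ℕ → Submodule R A) (d : A →ₗ[R] A) : Submodule R (cocycles 𝒜 d) :=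
  (decomposables 𝒜).comap (cocycles 𝒜 d).subtype

/-- `P(A) = Z(A⁺) / (Z(A⁺) ∩ (A⁺)²)`. -/
abbrev Prim (𝒜 : ℕ → Submodule R A) (d : A →ₗ[R] A) : Type _ :=
  cocycles 𝒜 d ⧸ decCocycles 𝒜 d

/-- The group of automorphisms of the graded algebra with differential `(A, 𝒜, d)`: the algebra
automorphisms that preserve the degree and commute with `d`. -/
def dgAut (𝒜 : ℕ → Submodule R A) (d : A →ₗ[R] A) : Subgroup (A ≃ₐ[R] A) where
  carrier := {f | (∀ n, (𝒜 n).map f.toLinearMap = 𝒜 n) ∧ ∀ x, f (d x) = d (f x)}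
  one_mem' := ⟨fun n => Submodule.map_id _, fun _ => rfl⟩
  mul_mem' := by
    rintro f g ⟨hf, hf'⟩ ⟨hg, hg'⟩
    refine ⟨fun n => ?_, fun x => ?_⟩
    · have : (f * g).toLinearMap = f.toLinearMap ∘ₗ g.toLinearMap := rfl
      rw [this, Submodule.map_comp, hg, hf]
    · rw [AlgEquiv.mul_apply, AlgEquiv.mul_apply, hg', hf']
  inv_mem' := by
    rintro f ⟨hf, hf'⟩
    refine ⟨fun n => ?_, fun x => ?_⟩
    · have : (f⁻¹).toLinearMap ∘ₗ f.toLinearMap = LinearMap.id := by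
        ext x
        exact f.symm_apply_apply x
      conv_lhs => rw [← hf n]
      rw [← Submodule.map_comp, this, Submodule.map_id]
    · apply f.injective
      rw [hf']
      exact (f.apply_symm_apply (d x)).trans (congrArg d (f.apply_symm_apply x).symm)

theorem dgAut_augIdeal {𝒜 : ℕ → Submodule R A} {d : A →ₗ[R] A} (f : dgAut 𝒜 d) :
    augIdeal 𝒜 ≤ (augIdeal 𝒜).comap f.1.toLinearMap := by
  refine iSup₂_le fun n hn => ?_
  rw [← Submodule.map_le_iff_le_comap, f.2.1 n]
  exact le_iSup₂_of_le n hn le_rfl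

theorem dgAut_cocycles {𝒜 : ℕ → Submodule R A} {d : A →ₗ[R] A} (f : dgAut 𝒜 d) :
    ∀ x ∈ cocycles 𝒜 d, f.1.toLinearMap x ∈ cocycles 𝒜 d := by
  rintro x ⟨hx, hx'⟩
  refine ⟨?_, dgAut_augIdeal f hx'⟩
  have h := f.2.2 x
  rw [LinearMap.mem_ker.1 hx, map_zero] at h
  exact LinearMap.mem_ker.2 h.symm

theorem dgAut_decomposables {𝒜 : ℕ → Submodule R A} {d : A →ₗ[R] A} (f : dgAut 𝒜 d) :
    decomposables 𝒜 ≤ (decomposables 𝒜).comap f.1.toLinearMap := by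
  refine Submodule.mul_le.2 fun x hx y hy => ?_
  change f.1 (x * y) ∈ decomposables 𝒜
  rw [map_mul]
  exact Submodule.mul_mem_mul (dgAut_augIdeal f hx) (dgAut_augIdeal f hy)

/-- The action of `Aut A` on `P(A)` by linear endomorphisms. -/
def primEnd (𝒜 : ℕ → Submodule R A) (d : A →ₗ[R] A) :
    dgAut 𝒜 d →* Module.End R (Prim 𝒜 d) where
  toFun f := (decCocycles 𝒜 d).mapQ (decCocycles 𝒜 d)
    (f.1.toLinearMap.restrict (dgAut_cocycles f)) (fun x hx => dgAut_decomposables f hx)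
  map_one' := by
    ext x
    rfl
  map_mul' f g := by
    ext x
    rfl

end Graded

/-! ### Extension of scalars

For a commutative `ℝ`-algebra `R`, the `R`-algebra `R ⊗ M` carries the extended grading and
differential, and `R ⊗ P(M) ≃ P(R ⊗ M)`. -/

section BaseChange

variable (R : Type v) [CommRing R] [Algebra ℝ R] {M : Type u} [Ring M] [Algebra ℝ M]

/-- The grading `R ⊗ Mⁿ` of `R ⊗ M`. -/
def gradingBC (𝒜 : ℕ → Submodule ℝ M) : ℕ → Submodule R (R ⊗[ℝ] M) :=
  fun n => (𝒜 n).baseChange R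

theorem augIdeal_gradingBC (𝒜 : ℕ → Submodule ℝ M) :
    augIdeal (gradingBC R 𝒜) = (augIdeal 𝒜).baseChange R := by
  apply le_antisymm
  · exact iSup₂_le fun n hn => Submodule.baseChange_mono R (le_iSup₂_of_le n hn le_rfl)
  · rw [Submodule.baseChange_eq_span, Submodule.span_le]
    rintro _ ⟨x, hx, rfl⟩
    have : augIdeal 𝒜 ≤ ((augIdeal (gradingBC R 𝒜)).restrictScalars ℝ).comap
        (TensorProduct.mk ℝ R M 1) := by
      refine iSup₂_le fun n hn x hx => ?_
      exact (le_iSup₂_of_le (f := fun n (_ : 0 < n) => gradingBC R 𝒜 n) n hn le_rfl)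
        (Submodule.tmul_mem_baseChange_of_mem 1 hx)
    exact this hx

theorem decomposables_gradingBC (𝒜 : ℕ → Submodule ℝ M) :
    decomposables (gradingBC R 𝒜) = (decomposables 𝒜).baseChange R := by
  unfold decomposables
  rw [augIdeal_gradingBC]
  apply le_antisymm
  · rw [Submodule.baseChange_eq_span, Submodule.span_mul_span, Submodule.span_le]
    rintro _ ⟨_, ⟨x, hx, rfl⟩, _, ⟨y, hy, rfl⟩, rfl⟩
    simp only [TensorProduct.mk_apply, Algebra.TensorProduct.tmul_mul_tmul, mul_one]
    exact Submodule.tmul_mem_baseChange_of_mem 1 (Submodule.mul_mem_mul hx hy)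
  · rw [Submodule.baseChange_eq_span R (augIdeal 𝒜 * augIdeal 𝒜), Submodule.span_le]
    rintro _ ⟨x, hx, rfl⟩
    have : augIdeal 𝒜 * augIdeal 𝒜 ≤
        (((augIdeal 𝒜).baseChange R * (augIdeal 𝒜).baseChange R).restrictScalars ℝ).comap
        (TensorProduct.mk ℝ R M 1) := by
      refine Submodule.mul_le.2 fun x hx y hy => ?_
      have h := Submodule.mul_mem_mul (Submodule.tmul_mem_baseChange_of_mem (1 : R) hx)
        (Submodule.tmul_mem_baseChange_of_mem (1 : R) hy)
      rw [Algebra.TensorProduct.tmul_mul_tmul, mul_one] at h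
      exact h
    exact this hx

theorem ker_baseChange_eq {W W' : Type u} [AddCommGroup W] [Module ℝ W] [AddCommGroup W']
    [Module ℝ W'] (f : W →ₗ[ℝ] W') :
    LinearMap.ker (f.baseChange R) = (LinearMap.ker f).baseChange R :=
  Module.Flat.ker_lTensor_eq R R f

theorem baseChange_inf_eq {W : Type u} [AddCommGroup W] [Module ℝ W] (p q : Submodule ℝ W) :
    (p ⊓ q).baseChange R = p.baseChange R ⊓ q.baseChange R := by
  apply le_antisymm
  · exact le_inf (Submodule.baseChange_mono R inf_le_left) (Submodule.baseChange_mono R inf_le_right)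
  · rintro x ⟨⟨y, rfl⟩, hx⟩
    have h1 : q.baseChange R = LinearMap.ker (q.mkQ.baseChange R) := by
      rw [ker_baseChange_eq, Submodule.ker_mkQ]
    rw [SetLike.mem_coe, h1, LinearMap.mem_ker, ← LinearMap.comp_apply,
      ← LinearMap.baseChange_comp, ← LinearMap.mem_ker, ker_baseChange_eq] at hx
    obtain ⟨z, rfl⟩ := hx
    have h2 : ∀ w : LinearMap.ker (q.mkQ ∘ₗ p.subtype), ((w : p) : W) ∈ p ⊓ q := fun w =>
      ⟨w.1.2, (Submodule.Quotient.mk_eq_zero q).1 (LinearMap.mem_ker.1 w.2)⟩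
    refine ⟨(LinearMap.codRestrict (p ⊓ q) (p.subtype ∘ₗ (LinearMap.ker
      (q.mkQ ∘ₗ p.subtype)).subtype) h2).baseChange R z, ?_⟩
    rw [← LinearMap.comp_apply, ← LinearMap.comp_apply, ← LinearMap.baseChange_comp,
      ← LinearMap.baseChange_comp]
    rfl

theorem cocycles_gradingBC (𝒜 : ℕ → Submodule ℝ M) (d : M →ₗ[ℝ] M) :
    cocycles (gradingBC R 𝒜) (d.baseChange R) = (cocycles 𝒜 d).baseChange R := by
  unfold cocycles
  rw [baseChange_inf_eq, ker_baseChange_eq, augIdeal_gradingBC]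

/-- The map `P(M) → P(R ⊗ M)` that sends the class of `z` to the class of `1 ⊗ z`. -/
def primToBC (𝒜 : ℕ → Submodule ℝ M) (d : M →ₗ[ℝ] M) :
    Prim 𝒜 d →ₗ[ℝ] Prim (gradingBC R 𝒜) (d.baseChange R) :=
  (decCocycles 𝒜 d).liftQ
    { toFun := fun z => Submodule.Quotient.mk ⟨1 ⊗ₜ[ℝ] (z : M), by
        rw [cocycles_gradingBC]
        exact Submodule.tmul_mem_baseChange_of_mem 1 z.2⟩
      map_add' := fun x y => by
        rw [← Submodule.Quotient.mk_add]
        congr 1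
        exact Subtype.ext (TensorProduct.tmul_add _ _ _)
      map_smul' := fun r x => by
        rw [← Submodule.Quotient.mk_smul]
        congr 1
        exact Subtype.ext (TensorProduct.tmul_smul _ _ _) }
    (fun z hz => by
      rw [LinearMap.mem_ker]
      refine (Submodule.Quotient.mk_eq_zero _).2 ?_
      change (1 : R) ⊗ₜ[ℝ] (z : M) ∈ decomposables (gradingBC R 𝒜)
      rw [decomposables_gradingBC]
      exact Submodule.tmul_mem_baseChange_of_mem 1 hz)

/-- The natural map `R ⊗ P(M) → P(R ⊗ M)`, `r ⊗ [z] ↦ [r ⊗ z]`. -/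
def primBCMap (𝒜 : ℕ → Submodule ℝ M) (d : M →ₗ[ℝ] M) :
    R ⊗[ℝ] Prim 𝒜 d →ₗ[R] Prim (gradingBC R 𝒜) (d.baseChange R) :=
  (primToBC R 𝒜 d).liftBaseChange R

theorem primBCMap_mkQ (𝒜 : ℕ → Submodule ℝ M) (d : M →ₗ[ℝ] M)
    (y : R ⊗[ℝ] cocycles 𝒜 d) :
    primBCMap R 𝒜 d ((decCocycles 𝒜 d).mkQ.baseChange R y) =
      Submodule.Quotient.mk ⟨(cocycles 𝒜 d).subtype.baseChange R y, by
        rw [cocycles_gradingBC]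
        exact ⟨y, rfl⟩⟩ := by
  induction y with
  | zero =>
    rw [map_zero, map_zero]
    symm
    rw [Submodule.Quotient.mk_eq_zero]
    change (cocycles 𝒜 d).subtype.baseChange R 0 ∈ decomposables (gradingBC R 𝒜)
    rw [map_zero]
    exact zero_mem _
  | add x y hx hy =>
    rw [map_add, map_add, hx, hy, ← Submodule.Quotient.mk_add]
    congr 1
    exact Subtype.ext (map_add _ _ _).symm
  | tmul r z =>
    change r • primToBC R 𝒜 d (Submodule.Quotient.mk z) = _
    change r • Submodule.Quotient.mk _ = _
    rw [← Submodule.Quotient.mk_smul]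
    congr 1
    apply Subtype.ext
    change r • (1 ⊗ₜ[ℝ] (z : M)) = r ⊗ₜ[ℝ] (z : M)
    rw [TensorProduct.smul_tmul', smul_eq_mul, mul_one]

theorem primBCMap_bijective (𝒜 : ℕ → Submodule ℝ M) (d : M →ₗ[ℝ] M) :
    Function.Bijective (primBCMap R 𝒜 d) := by
  have hsurj : Function.Surjective ((decCocycles 𝒜 d).mkQ.baseChange R) :=
    LinearMap.lTensor_surjective R (Submodule.mkQ_surjective _)
  have hinj : Function.Injective ((cocycles 𝒜 d).subtype.baseChange R) :=
    Module.Flat.lTensor_preserves_injective_linearMap (M := R) _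
      (Submodule.injective_subtype _)
  constructor
  · rw [injective_iff_map_eq_zero]
    intro t ht
    obtain ⟨y, rfl⟩ := hsurj t
    rw [primBCMap_mkQ, Submodule.Quotient.mk_eq_zero] at ht
    change (cocycles 𝒜 d).subtype.baseChange R y ∈ decomposables (gradingBC R 𝒜) at ht
    rw [decomposables_gradingBC] at ht
    have h : (cocycles 𝒜 d).subtype.baseChange R y ∈
        (cocycles 𝒜 d ⊓ decomposables 𝒜).baseChange R := by
      rw [baseChange_inf_eq]
      exact ⟨⟨y, rfl⟩, ht⟩
    obtain ⟨w, hw⟩ := h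
    let j : (cocycles 𝒜 d ⊓ decomposables 𝒜 : Submodule ℝ M) →ₗ[ℝ] cocycles 𝒜 d :=
      Submodule.inclusion inf_le_left
    have hy : y = j.baseChange R w := by
      apply hinj
      rw [← hw, ← LinearMap.comp_apply, ← LinearMap.baseChange_comp]
      rfl
    have hz : (decCocycles 𝒜 d).mkQ ∘ₗ j = 0 := by
      ext x
      exact (Submodule.Quotient.mk_eq_zero _).2 x.2.2
    rw [hy, ← LinearMap.comp_apply, ← LinearMap.baseChange_comp, hz, LinearMap.baseChange_zero,
      LinearMap.zero_apply]
  · intro t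
    obtain ⟨⟨x, hx⟩, rfl⟩ := Submodule.Quotient.mk_surjective _ t
    have hx' := hx
    rw [cocycles_gradingBC] at hx'
    obtain ⟨y, rfl⟩ := hx'
    exact ⟨_, primBCMap_mkQ R 𝒜 d y⟩

/-- The natural isomorphism `R ⊗ P(M) ≃ P(R ⊗ M)`. -/
def primBC (𝒜 : ℕ → Submodule ℝ M) (d : M →ₗ[ℝ] M) :
    (R ⊗[ℝ] Prim 𝒜 d) ≃ₗ[R] Prim (gradingBC R 𝒜) (d.baseChange R) :=
  LinearEquiv.ofBijective (primBCMap R 𝒜 d) (primBCMap_bijective R 𝒜 d)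

/-- The `R`-points of the group scheme `Aut M`: the automorphisms of the graded algebra with
differential `R ⊗ M` over `R`. -/
abbrev AutPoints (𝒜 : ℕ → Submodule ℝ M) (d : M →ₗ[ℝ] M) :
    Subgroup ((R ⊗[ℝ] M) ≃ₐ[R] (R ⊗[ℝ] M)) :=
  dgAut (gradingBC R 𝒜) (d.baseChange R)

/-- The homomorphism `Aut M → GL(P(M))` on `R`-points. -/
def primGL (𝒜 : ℕ → Submodule ℝ M) (d : M →ₗ[ℝ] M) :
    AutPoints R 𝒜 d →* ((R ⊗[ℝ] Prim 𝒜 d) ≃ₗ[R] (R ⊗[ℝ] Prim 𝒜 d)) :=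
  (LinearMap.GeneralLinearGroup.generalLinearEquiv R (R ⊗[ℝ] Prim 𝒜 d)).toMonoidHom.comp
    (((primBC R 𝒜 d).symm.conjRingEquiv : _ →* Module.End R (R ⊗[ℝ] Prim 𝒜 d)).comp
      (primEnd (gradingBC R 𝒜) (d.baseChange R))).toHomUnits

/-- Under the identification of `R ⊗ P(M)` with `P(R ⊗ M)`, an automorphism `f` of `R ⊗ M` acts by
`[z] ↦ [f z]`. -/
theorem primBC_primGL (𝒜 : ℕ → Submodule ℝ M) (d : M →ₗ[ℝ] M) (f : AutPoints R 𝒜 d)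
    (t : R ⊗[ℝ] Prim 𝒜 d) (z : cocycles (gradingBC R 𝒜) (d.baseChange R))
    (h : primBC R 𝒜 d t = Submodule.Quotient.mk z) :
    primBC R 𝒜 d (primGL R 𝒜 d f t) =
      Submodule.Quotient.mk ⟨f.1 z, dgAut_cocycles f z z.2⟩ := by
  change primBC R 𝒜 d ((primBC R 𝒜 d).symm
    (primEnd (gradingBC R 𝒜) (d.baseChange R) f (primBC R 𝒜 d t))) = _
  rw [LinearEquiv.apply_symm_apply, h]
  rfl

end BaseChange

/-! ### Algebraic groups, split tori and their actions

An affine group scheme `T` over `ℝ` is given by its coordinate ring, a commutative Hopf algebra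
`H`. Its `R`-points are the algebra homomorphisms `H → R` with the convolution product. -/

section Actions

/-- The `R`-points `T(R)`, a group under convolution. -/
abbrev Points (H : Type v) [CommRing H] [HopfAlgebra ℝ H] (R : Type v) [CommRing R]
    [Algebra ℝ R] : Type v :=
  WithConv (H →ₐ[ℝ] R)

/-- `T` is an `ℝ`-split torus of dimension `n`: it is isomorphic over `ℝ` to `𝔾ₘⁿ`, whose
coordinate ring is the Hopf algebra `ℝ[ℤⁿ]` of Laurent polynomials. -/
def IsSplitTorus (H : Type v) [CommRing H] [HopfAlgebra ℝ H] (n : ℕ) : Prop :=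
  Nonempty (H ≃ₐc[ℝ] AddMonoidAlgebra ℝ (Fin n → ℤ))

/-- The character group `𝔛(T) = Hom(T, 𝔾ₘ)`, as the group of group-like elements of the
coordinate ring; the value of `χ` at a point `g : H → R` is `g χ`. The group law is written
multiplicatively. -/
abbrev Character (H : Type v) [CommRing H] [HopfAlgebra ℝ H] : Type v :=
  GroupLike ℝ H

/-- The weight space `W_χ = {w ∈ W | t · w = χ(t) w for all t ∈ T}` of a linear action of `T`
on `W`, where `t` runs through the points of `T` with values in all `ℝ`-algebras. -/
def weightSpace {H : Type v} [CommRing H] [HopfAlgebra ℝ H] {W : Type*} [AddCommGroup W]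
    [Module ℝ W]
    (ρ : ∀ (R : Type v) [CommRing R] [Algebra ℝ R], Points H R → Module.End R (R ⊗[ℝ] W))
    (χ : Character H) : Submodule ℝ W where
  carrier := {w | ∀ (R : Type v) [CommRing R] [Algebra ℝ R] (g : Points H R),
    ρ R g (1 ⊗ₜ[ℝ] w) = g.ofConv χ.val ⊗ₜ[ℝ] w}
  zero_mem' := by
    intro R _ _ g
    rw [TensorProduct.tmul_zero, TensorProduct.tmul_zero, map_zero]
  add_mem' := by
    intro x y hx hy R _ _ g
    rw [TensorProduct.tmul_add, TensorProduct.tmul_add, map_add, hx R g, hy R g]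
  smul_mem' := by
    intro r x hx R _ _ g
    rw [TensorProduct.tmul_smul, TensorProduct.tmul_smul, ← hx R g]
    exact LinearMap.map_smul_of_tower _ r _

/-- The weights of a linear action: the characters with a nonzero weight space. -/
def weights {H : Type v} [CommRing H] [HopfAlgebra ℝ H] {W : Type*} [AddCommGroup W]
    [Module ℝ W]
    (ρ : ∀ (R : Type v) [CommRing R] [Algebra ℝ R], Points H R → Module.End R (R ⊗[ℝ] W)) :
    Set (Character H) :=
  {χ | weightSpace ρ χ ≠ ⊥}

variable {M : Type u} [Ring M] [Algebra ℝ M]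

/-- An action of `T` on `M`: a morphism `T → Aut M` of group schemes over `ℝ`, that is, a family
of group homomorphisms `T(R) → Aut(M)(R)`, natural in the `ℝ`-algebra `R`. -/
structure Action (H : Type v) [CommRing H] [HopfAlgebra ℝ H] (𝒜 : ℕ → Submodule ℝ M)
    (d : M →ₗ[ℝ] M) where
  hom : ∀ (R : Type v) [CommRing R] [Algebra ℝ R], Points H R →* AutPoints R 𝒜 d
  natural : ∀ (R S : Type v) [CommRing R] [Algebra ℝ R] [CommRing S] [Algebra ℝ S]
    (φ : R →ₐ[ℝ] S) (g : Points H R) (x : R ⊗[ℝ] M),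
    (hom S (WithConv.toConv (φ.comp g.ofConv))).1 (φ.toLinearMap.rTensor M x) =
      φ.toLinearMap.rTensor M ((hom R g).1 x)

namespace Action

variable {H : Type v} [CommRing H] [HopfAlgebra ℝ H] {𝒜 : ℕ → Submodule ℝ M} {d : M →ₗ[ℝ] M}

/-- The underlying linear action of `T` on `M`. -/
def onM (ρ : Action H 𝒜 d) (R : Type v) [CommRing R] [Algebra ℝ R] (g : Points H R) :
    Module.End R (R ⊗[ℝ] M) :=
  (ρ.hom R g).1.toLinearMap

/-- The composition `T → Aut M → GL(P(M))` on `R`-points. -/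
def toGLPrim (ρ : Action H 𝒜 d) (R : Type v) [CommRing R] [Algebra ℝ R] :
    Points H R →* ((R ⊗[ℝ] Prim 𝒜 d) ≃ₗ[R] (R ⊗[ℝ] Prim 𝒜 d)) :=
  (primGL R 𝒜 d).comp (ρ.hom R)

/-- The linear action of `T` on `P(M)`. -/
def onPrim (ρ : Action H 𝒜 d) (R : Type v) [CommRing R] [Algebra ℝ R] (g : Points H R) :
    Module.End R (R ⊗[ℝ] Prim 𝒜 d) :=
  (ρ.toGLPrim R g).toLinearMap

/-- `T → Aut M` is injective (on points in every `ℝ`-algebra), that is, `T ⊆ Aut M`. -/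
def IsFaithful (ρ : Action H 𝒜 d) : Prop :=
  ∀ (R : Type v) [CommRing R] [Algebra ℝ R], Function.Injective (ρ.hom R)

/-- For `T, T' ⊆ Aut M`: the inclusion `T ⊆ T'` of subgroups of `Aut M`. -/
def IsContainedIn {H' : Type v} [CommRing H'] [HopfAlgebra ℝ H'] (ρ : Action H 𝒜 d)
    (ρ' : Action H' 𝒜 d) : Prop :=
  ∀ (R : Type v) [CommRing R] [Algebra ℝ R], Set.range (ρ.hom R) ⊆ Set.range (ρ'.hom R)

/-- `T` is a maximal `ℝ`-split torus of `Aut M`: it is a split torus contained in `Aut M`, and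
every split torus of `Aut M` that contains `T` is equal to `T`. -/
def IsMaximalSplitTorus (ρ : Action H 𝒜 d) : Prop :=
  (∃ n, IsSplitTorus H n) ∧ ρ.IsFaithful ∧
    ∀ (H' : Type v) [CommRing H'] [HopfAlgebra ℝ H'] (n' : ℕ), IsSplitTorus H' n' →
      ∀ ρ' : Action H' 𝒜 d, ρ'.IsFaithful → ρ.IsContainedIn ρ' → ρ'.IsContainedIn ρ

end Action

end Actions

/-! ### Free graded commutative algebras and Sullivan algebras -/

section Sullivan

variable {V : Type u} [AddCommGroup V] [Module ℝ V]

/-- The relations `v w = (-1)^{ij} w v` for `v ∈ Vⁱ`, `w ∈ Vʲ`. -/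
inductive CommRel (𝒱 : ℕ → Submodule ℝ V) : TensorAlgebra ℝ V → TensorAlgebra ℝ V → Prop
  | comm (i j : ℕ) (v w : V) (hv : v ∈ 𝒱 i) (hw : w ∈ 𝒱 j) :
      CommRel 𝒱 (TensorAlgebra.ι ℝ v * TensorAlgebra.ι ℝ w)
        ((-1 : ℝ) ^ (i * j) • (TensorAlgebra.ι ℝ w * TensorAlgebra.ι ℝ v))

/-- The free graded commutative algebra `S(V)` on the graded vector space `V = ⨁ Vⁿ`. -/
def FreeGCA (𝒱 : ℕ → Submodule ℝ V) : Type u :=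
  RingQuot (CommRel 𝒱)

instance (𝒱 : ℕ → Submodule ℝ V) : Ring (FreeGCA 𝒱) :=
  inferInstanceAs (Ring (RingQuot (CommRel 𝒱)))

instance (𝒱 : ℕ → Submodule ℝ V) : Algebra ℝ (FreeGCA 𝒱) :=
  inferInstanceAs (Algebra ℝ (RingQuot (CommRel 𝒱)))

/-- The inclusion `V → S(V)`. -/
def gen (𝒱 : ℕ → Submodule ℝ V) : V →ₗ[ℝ] FreeGCA 𝒱 :=
  (RingQuot.mkAlgHom ℝ (CommRel 𝒱)).toLinearMap ∘ₗ TensorAlgebra.ι ℝ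

/-- The generating space `V`, as a subspace of `S(V)`. -/
def genSpace (𝒱 : ℕ → Submodule ℝ V) : Submodule ℝ (FreeGCA 𝒱) :=
  LinearMap.range (gen 𝒱)

/-- The component `S(V)ⁿ` of degree `n`: the span of the products `v₁ ⋯ v_r` (`r ≥ 0`) of
homogeneous elements of `V` whose degrees add up to `n`. -/
def grading (𝒱 : ℕ → Submodule ℝ V) (n : ℕ) : Submodule ℝ (FreeGCA 𝒱) :=
  Submodule.span ℝ {x | ∃ l : List (Σ i : ℕ, 𝒱 i),
    (l.map (fun v => v.1)).sum = n ∧ x = (l.map (fun v => gen 𝒱 (v.2 : V))).prod}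

/-- `(S(V), d)` is a Sullivan algebra. -/
structure IsSullivan (𝒱 : ℕ → Submodule ℝ V) (d : FreeGCA 𝒱 →ₗ[ℝ] FreeGCA 𝒱) : Prop where
  /-- `V` is the direct sum of the `Vⁿ`, and these vanish unless `n > 0`. -/
  isInternal : DirectSum.IsInternal 𝒱
  positive : 𝒱 0 = ⊥
  /-- `d` is a derivation of degree `1` with `d² = 0`. -/
  degree : ∀ n, ∀ x ∈ grading 𝒱 n, d x ∈ grading 𝒱 (n + 1)
  leibniz : ∀ n, ∀ x ∈ grading 𝒱 n, ∀ y, d (x * y) = d x * y + (-1 : ℝ) ^ n • (x * d y)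
  d_d : ∀ x, d (d x) = 0
  /-- `V` is the union of an increasing sequence of graded subspaces `V(k)` with `d (V(0)) = 0`
  and `d (V(k+1)) ⊆ S(V(k))`. -/
  nilpotence : ∃ F : ℕ → Submodule ℝ V, Monotone F ∧ (∀ k, F k = ⨆ n, F k ⊓ 𝒱 n) ∧
    (∀ v, ∃ k, v ∈ F k) ∧ (∀ v ∈ F 0, d (gen 𝒱 v) = 0) ∧
    ∀ k, ∀ v ∈ F (k + 1), d (gen 𝒱 v) ∈ Algebra.adjoin ℝ (gen 𝒱 '' (F k : Set V))

/-- The Sullivan algebra `M = (S(V), d)` is minimal: `d M ⊆ M⁺ · M⁺`. -/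
def IsMinimal (𝒱 : ℕ → Submodule ℝ V) (d : FreeGCA 𝒱 →ₗ[ℝ] FreeGCA 𝒱) : Prop :=
  ∀ x, d x ∈ decomposables (grading 𝒱)

/-- `d` is quadratic: it maps `V` to `S²(V) = V · V`. -/
def IsQuadratic (𝒱 : ℕ → Submodule ℝ V) (d : FreeGCA 𝒱 →ₗ[ℝ] FreeGCA 𝒱) : Prop :=
  ∀ x ∈ genSpace 𝒱, d x ∈ genSpace 𝒱 * genSpace 𝒱

/-- The natural map `Z(M⁺) ∩ V → P(M)`, which sends a cocycle in `V` to its class. -/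
def genToPrim (𝒱 : ℕ → Submodule ℝ V) (d : FreeGCA 𝒱 →ₗ[ℝ] FreeGCA 𝒱) :
    (genSpace 𝒱).comap (cocycles (grading 𝒱) d).subtype →ₗ[ℝ] Prim (grading 𝒱) d :=
  (decCocycles (grading 𝒱) d).mkQ.domRestrict _

end Sullivan

end

end SplitTori

namespace SplitTori

section FreeAlgebra

variable {V : Type u} [AddCommGroup V] [Module ℝ V] {𝒱 : ℕ → Submodule ℝ V}

/-! ### The free graded commutative algebra -/

/-! A split torus `T` is diagonalizable: its characters form a basis of the coordinate ring `H`.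
Expanding the coaction `M → H ⊗ M` (the action of the generic point) in this basis splits every `x`
into weight components `x_χ` (`weightComp`). The component maps commute with `d`, preserve degrees
and cocycles, and are multiplicative in the sense that `M_χ · M_ψ ⊆ M_{χψ}`.

For (i), let `S` be the monoid generated by the weights of `P(M)`, and `A` the subalgebra of vectors
with weights in `S`. That `A = M` is shown by induction on the degree and, within a degree, on the
filtration `V(k)`. By minimality, `dv` for `v ∈ V(k+1)` of degree `n` is decomposable of degree `n +
1`, so it only involves generators of `V(k)` of degree at most `n`, and `dv ∈ A`
(`mem_of_mem_adjoin`). If `χ ∉ S`, then `v_χ` is therefore a cocycle. Its class in `P(M)` has a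
weight that does not occur, so `v_χ` is decomposable, hence a polynomial in generators of smaller
degree, and lies in `A` (`mem_of_decomposable`). Thus `v_χ = 0` (`weightSubalgebra_eq_top`).

For (ii), a point of `T` acts on `M` through the values of the weights, and these are determined by
the values on the weights of `P(M)`. If the action is faithful, the weights of `M` generate the
character group `ℤⁿ`, since otherwise a nontrivial point would be killed by all of them. So the
weights of `P(M)` generate it too, and there are at most `dim P(M)` of those.

For (iii), an inclusion `T ⊆ T'` gives a surjection of character lattices `ℤ^{n'} → ℤⁿ`, while (ii)
for `T'` gives `n' ≤ dim P(M) = n`. So it is an isomorphism.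

Part (iv) compares word lengths: `d` sends decomposables to length at least 3, whereas `dv` has
length 2 for `v ∈ V`. In a cocycle `v + y` with `y` decomposable, both `dv` and `dy` must then
vanish. -/

theorem gen_mul_gen {i j : ℕ} {v w : V} (hv : v ∈ 𝒱 i) (hw : w ∈ 𝒱 j) :
    gen 𝒱 v * gen 𝒱 w = (-1 : ℝ) ^ (i * j) • (gen 𝒱 w * gen 𝒱 v) := by
  have h := RingQuot.mkAlgHom_rel ℝ (CommRel.comm i j v w hv hw)
  rw [map_mul, map_smul, map_mul] at h
  exact h

/-- The universal property of `S(V)`. -/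
noncomputable def liftFree {B : Type*} [Ring B] [Algebra ℝ B] (f : V →ₗ[ℝ] B)
    (hf : ∀ i j v w, v ∈ 𝒱 i → w ∈ 𝒱 j → f v * f w = (-1 : ℝ) ^ (i * j) • (f w * f v)) :
    FreeGCA 𝒱 →ₐ[ℝ] B :=
  RingQuot.liftAlgHom ℝ ⟨TensorAlgebra.lift ℝ f, by
    rintro _ _ ⟨i, j, v, w, hv, hw⟩
    rw [map_mul, map_smul, map_mul, TensorAlgebra.lift_ι_apply, TensorAlgebra.lift_ι_apply]
    exact hf i j v w hv hw⟩

theorem liftFree_gen {B : Type*} [Ring B] [Algebra ℝ B] (f : V →ₗ[ℝ] B)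
    (hf : ∀ i j v w, v ∈ 𝒱 i → w ∈ 𝒱 j → f v * f w = (-1 : ℝ) ^ (i * j) • (f w * f v)) (v : V) :
    liftFree f hf (gen 𝒱 v) = f v := by
  refine (RingQuot.liftAlgHom_mkAlgHom_apply ℝ _ _ _).trans ?_
  rw [TensorAlgebra.lift_ι_apply]

theorem adjoin_range_gen : Algebra.adjoin ℝ (Set.range (gen 𝒱)) = ⊤ := by
  have h : Set.range (gen 𝒱) =
      RingQuot.mkAlgHom ℝ (CommRel 𝒱) '' Set.range (TensorAlgebra.ι ℝ (M := V)) := by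
    rw [← Set.range_comp]
    rfl
  rw [h]
  refine (AlgHom.map_adjoin (RingQuot.mkAlgHom ℝ (CommRel 𝒱)) _).symm.trans ?_
  rw [TensorAlgebra.adjoin_range_ι, Algebra.map_top]
  exact (AlgHom.range_eq_top _).2 (RingQuot.mkAlgHom_surjective ℝ _)

theorem gen_mem_grading {n : ℕ} {v : V} (hv : v ∈ 𝒱 n) : gen 𝒱 v ∈ grading 𝒱 n :=
  Submodule.subset_span ⟨[⟨n, v, hv⟩], by simp, by simp⟩

theorem one_mem_grading : (1 : FreeGCA 𝒱) ∈ grading 𝒱 0 :=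
  Submodule.subset_span ⟨[], by simp, by simp⟩

theorem grading_mul_le (m n : ℕ) : grading 𝒱 m * grading 𝒱 n ≤ grading 𝒱 (m + n) := by
  unfold grading
  rw [Submodule.span_mul_span, Submodule.span_le]
  rintro _ ⟨_, ⟨l, hl, rfl⟩, _, ⟨l', hl', rfl⟩, rfl⟩
  exact Submodule.subset_span ⟨l ++ l', by simp [hl, hl'], by simp⟩

theorem mul_mem_grading {m n : ℕ} {x y : FreeGCA 𝒱} (hx : x ∈ grading 𝒱 m)
    (hy : y ∈ grading 𝒱 n) : x * y ∈ grading 𝒱 (m + n) :=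
  grading_mul_le m n (Submodule.mul_mem_mul hx hy)

theorem grading_le_augIdeal {n : ℕ} (hn : 0 < n) : grading 𝒱 n ≤ augIdeal (grading 𝒱) :=
  le_iSup₂_of_le n hn le_rfl

theorem decomposables_le_iff {p : Submodule ℝ (FreeGCA 𝒱)} :
    decomposables (grading 𝒱) ≤ p ↔ ∀ i j, 0 < i → 0 < j →
      ∀ x ∈ grading 𝒱 i, ∀ y ∈ grading 𝒱 j, x * y ∈ p := by
  constructor
  · intro h i j hi hj x hx y hy
    exact h (Submodule.mul_mem_mul (grading_le_augIdeal hi hx) (grading_le_augIdeal hj hy))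
  · intro h
    unfold decomposables augIdeal
    simp only [Submodule.iSup_mul, Submodule.mul_iSup, iSup_le_iff]
    intro j hj i hi
    exact Submodule.mul_le.2 fun x hx y hy => h i j hi hj x hx y hy

theorem decomposables_le_augIdeal : decomposables (grading 𝒱) ≤ augIdeal (grading 𝒱) :=
  decomposables_le_iff.2 fun _ _ hi _ _ hx _ hy =>
    grading_le_augIdeal (Nat.add_pos_left hi _) (mul_mem_grading hx hy)

theorem genSpace_le_augIdeal (hI : DirectSum.IsInternal 𝒱) (h0 : 𝒱 0 = ⊥) :
    genSpace 𝒱 ≤ augIdeal (grading 𝒱) := by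
  unfold genSpace
  rw [LinearMap.range_eq_map, ← hI.submodule_iSup_eq_top, Submodule.map_le_iff_le_comap]
  refine iSup_le fun n v hv => ?_
  rcases Nat.eq_zero_or_pos n with rfl | hn
  · rw [h0, Submodule.mem_bot] at hv
    rw [hv]
    exact zero_mem _
  · exact grading_le_augIdeal hn (gen_mem_grading hv)

theorem list_prod_mem_genSpace_sup (hI : DirectSum.IsInternal 𝒱) (h0 : 𝒱 0 = ⊥)
    (l : List (Σ i : ℕ, 𝒱 i)) (hl : l ≠ []) :
    (l.map (fun v => gen 𝒱 (v.2 : V))).prod ∈ genSpace 𝒱 ⊔ decomposables (grading 𝒱) := by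
  induction l with
  | nil => exact absurd rfl hl
  | cons a l ih =>
    rw [List.map_cons, List.prod_cons]
    have ha : gen 𝒱 (a.2 : V) ∈ genSpace 𝒱 := ⟨_, rfl⟩
    by_cases h : l = []
    · subst h
      rw [List.map_nil, List.prod_nil, mul_one]
      exact Submodule.mem_sup_left ha
    · exact Submodule.mem_sup_right (Submodule.mul_mem_mul (genSpace_le_augIdeal hI h0 ha)
        (sup_le (genSpace_le_augIdeal hI h0) decomposables_le_augIdeal (ih h)))

theorem augIdeal_eq_genSpace_sup (hI : DirectSum.IsInternal 𝒱) (h0 : 𝒱 0 = ⊥) :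
    augIdeal (grading 𝒱) = genSpace 𝒱 ⊔ decomposables (grading 𝒱) := by
  refine le_antisymm (iSup₂_le fun n hn => Submodule.span_le.2 ?_)
    (sup_le (genSpace_le_augIdeal hI h0) decomposables_le_augIdeal)
  rintro _ ⟨l, hl, rfl⟩
  refine list_prod_mem_genSpace_sup hI h0 l ?_
  rintro rfl
  simp at hl
  omega

/-! ### Grading homomorphisms to polynomials -/

/-- The linear map `V → S(V)[X]` that sends `v ∈ Vⁿ` to `v X^{e n}`. -/
noncomputable def expMap (hI : DirectSum.IsInternal 𝒱) (e : ℕ → ℕ) :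
    V →ₗ[ℝ] Polynomial (FreeGCA 𝒱) :=
  (DirectSum.toModule ℝ ℕ _ fun i =>
    ((Polynomial.monomial (R := FreeGCA 𝒱) (e i)).restrictScalars ℝ) ∘ₗ
      gen 𝒱 ∘ₗ (𝒱 i).subtype) ∘ₗ
    (LinearEquiv.ofBijective (DirectSum.coeLinearMap 𝒱) hI).symm.toLinearMap

theorem expMap_apply (hI : DirectSum.IsInternal 𝒱) (e : ℕ → ℕ) {n : ℕ} {v : V} (hv : v ∈ 𝒱 n) :
    expMap hI e v = Polynomial.monomial (e n) (gen 𝒱 v) := by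
  have h : (LinearEquiv.ofBijective (DirectSum.coeLinearMap 𝒱) hI).symm v =
      DirectSum.lof ℝ ℕ (fun i => 𝒱 i) n ⟨v, hv⟩ := by
    rw [LinearEquiv.symm_apply_eq]
    exact (DirectSum.coeLinearMap_lof 𝒱 n ⟨v, hv⟩).symm
  rw [expMap, LinearMap.comp_apply, LinearEquiv.coe_coe, h, DirectSum.toModule_lof]
  rfl

/-- The algebra homomorphism `S(V) → S(V)[X]` that sends `v ∈ Vⁿ` to `v X^{e n}`. -/
noncomputable def expHom (hI : DirectSum.IsInternal 𝒱) (e : ℕ → ℕ) :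
    FreeGCA 𝒱 →ₐ[ℝ] Polynomial (FreeGCA 𝒱) :=
  liftFree (expMap hI e) fun i j v w hv hw => by
    -- The variable `X` is central, so the sign in the relation is unaffected and only the exponents
    -- get interchanged.
    rw [expMap_apply hI e hv, expMap_apply hI e hw, Polynomial.monomial_mul_monomial,
      Polynomial.monomial_mul_monomial, gen_mul_gen hv hw, Polynomial.smul_monomial, add_comm]

theorem expHom_gen (hI : DirectSum.IsInternal 𝒱) (e : ℕ → ℕ) {n : ℕ} {v : V} (hv : v ∈ 𝒱 n) :
    expHom hI e (gen 𝒱 v) = Polynomial.monomial (e n) (gen 𝒱 v) := by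
  rw [expHom, liftFree_gen, expMap_apply hI e hv]

/-- With `e = id` the exponent is the degree, with `e = 1` the word length. Both gradings of `S(V)`
are thus read off from coefficients of polynomials. -/
theorem expHom_list_prod (hI : DirectSum.IsInternal 𝒱) (e : ℕ → ℕ) (l : List (Σ i : ℕ, 𝒱 i)) :
    expHom hI e (l.map (fun v => gen 𝒱 (v.2 : V))).prod =
      Polynomial.monomial (l.map fun v => e v.1).sum (l.map (fun v => gen 𝒱 (v.2 : V))).prod := by
  induction l with
  | nil =>
    simp only [List.map_nil, List.prod_nil, List.sum_nil, map_one]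
    rfl
  | cons a l ih =>
    rw [List.map_cons, List.prod_cons, map_mul, ih, expHom_gen hI e a.2.2,
      Polynomial.monomial_mul_monomial, List.map_cons, List.sum_cons]

/-- The projection of `S(V)` to its component of degree `n`. -/
noncomputable def degProj (hI : DirectSum.IsInternal 𝒱) (n : ℕ) : FreeGCA 𝒱 →ₗ[ℝ] FreeGCA 𝒱 :=
  ((Polynomial.lcoeff (FreeGCA 𝒱) n).restrictScalars ℝ) ∘ₗ (expHom hI id).toLinearMap

theorem degProj_apply (hI : DirectSum.IsInternal 𝒱) (n : ℕ) (x : FreeGCA 𝒱) :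
    degProj hI n x = (expHom hI id x).coeff n := rfl

theorem degProj_of_mem (hI : DirectSum.IsInternal 𝒱) {m : ℕ} {x : FreeGCA 𝒱}
    (hx : x ∈ grading 𝒱 m) (n : ℕ) : degProj hI n x = if m = n then x else 0 := by
  have h : grading 𝒱 m ≤ LinearMap.eqLocus (expHom hI id).toLinearMap
      ((Polynomial.monomial (R := FreeGCA 𝒱) m).restrictScalars ℝ) := by
    refine Submodule.span_le.2 ?_
    rintro _ ⟨l, hl, rfl⟩
    exact (expHom_list_prod hI id l).trans (by rw [← hl]; rfl)
  have h' : expHom hI id x = Polynomial.monomial m x := h hx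
  rw [degProj_apply, h', Polynomial.coeff_monomial]

theorem degProj_self (hI : DirectSum.IsInternal 𝒱) {n : ℕ} {x : FreeGCA 𝒱}
    (hx : x ∈ grading 𝒱 n) : degProj hI n x = x := by
  rw [degProj_of_mem hI hx, if_pos rfl]

theorem degProj_mul (hI : DirectSum.IsInternal 𝒱) (n : ℕ) (x y : FreeGCA 𝒱) :
    degProj hI n (x * y) =
      ∑ p ∈ Finset.HasAntidiagonal.antidiagonal n, degProj hI p.1 x * degProj hI p.2 y := by
  simp only [degProj_apply, map_mul, Polynomial.coeff_mul]

/-- Because `F` is graded, the homogeneous components of its elements stay in `F`. This serves both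
for `F = V` and for the steps `V(k)` of the filtration. -/
theorem degProj_gen_mem (hI : DirectSum.IsInternal 𝒱) {F : Submodule ℝ V}
    (hF : F = ⨆ n, F ⊓ 𝒱 n) {v : V} (hv : v ∈ F) (n : ℕ) :
    degProj hI n (gen 𝒱 v) ∈ (F ⊓ 𝒱 n).map (gen 𝒱) := by
  have h : F ≤ ((F ⊓ 𝒱 n).map (gen 𝒱)).comap (degProj hI n ∘ₗ gen 𝒱) := by
    conv_lhs => rw [hF]
    refine iSup_le fun m w hw => ?_
    rw [Submodule.mem_comap, LinearMap.comp_apply, degProj_of_mem hI (gen_mem_grading hw.2)]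
    split_ifs with hmn
    · subst hmn
      exact ⟨w, hw, rfl⟩
    · exact zero_mem _
  exact h hv

theorem degProj_mem (hI : DirectSum.IsInternal 𝒱) (n : ℕ) (x : FreeGCA 𝒱) :
    degProj hI n x ∈ grading 𝒱 n := by
  have hx : x ∈ Algebra.adjoin ℝ (Set.range (gen 𝒱)) := by
    rw [adjoin_range_gen]
    exact Algebra.mem_top
  induction hx using Algebra.adjoin_induction generalizing n with
  | mem x hx =>
    obtain ⟨v, rfl⟩ := hx
    have h : (⊤ : Submodule ℝ V) = ⨆ n, ⊤ ⊓ 𝒱 n := by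
      simp only [top_inf_eq]
      exact hI.submodule_iSup_eq_top.symm
    have hv : v ∈ (⊤ : Submodule ℝ V) := Submodule.mem_top
    obtain ⟨w, hw, hw'⟩ := degProj_gen_mem hI h hv n
    rw [← hw']
    exact gen_mem_grading hw.2
  | algebraMap r =>
    rw [Algebra.algebraMap_eq_smul_one, map_smul, degProj_of_mem hI one_mem_grading]
    split_ifs with h
    · subst h
      exact Submodule.smul_mem _ _ one_mem_grading
    · simp
  | add x y _ _ hx hy =>
    rw [map_add]
    exact add_mem (hx n) (hy n)
  | mul x y _ _ hx hy =>
    rw [degProj_mul]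
    refine sum_mem fun p hp => ?_
    rw [← Finset.HasAntidiagonal.mem_antidiagonal.1 hp]
    exact mul_mem_grading (hx _) (hy _)

theorem grading_zero_le (h0 : 𝒱 0 = ⊥) :
    grading 𝒱 0 ≤ (⊥ : Subalgebra ℝ (FreeGCA 𝒱)).toSubmodule := by
  refine Submodule.span_le.2 ?_
  rintro _ ⟨l, hl, rfl⟩
  cases l with
  | nil => exact one_mem (⊥ : Subalgebra ℝ (FreeGCA 𝒱))
  | cons a l =>
    obtain ⟨i, v, hv⟩ := a
    simp only [List.map_cons, List.sum_cons, Nat.add_eq_zero_iff] at hl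
    obtain ⟨rfl, -⟩ := hl
    rw [h0, Submodule.mem_bot] at hv
    subst hv
    rw [List.map_cons, List.prod_cons, map_zero, zero_mul]
    exact zero_mem _

theorem grading_le_of_gen_mem {A : Subalgebra ℝ (FreeGCA 𝒱)} {n : ℕ}
    (h : ∀ m ≤ n, ∀ v ∈ 𝒱 m, gen 𝒱 v ∈ A) : grading 𝒱 n ≤ A.toSubmodule := by
  refine Submodule.span_le.2 ?_
  rintro _ ⟨l, hl, rfl⟩
  refine list_prod_mem (S := A) fun x hx => ?_
  obtain ⟨a, ha, rfl⟩ := List.mem_map.1 hx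
  refine h a.1 ?_ _ a.2.2
  rw [← hl]
  exact List.single_le_sum (fun _ _ => Nat.zero_le _) _ (List.mem_map_of_mem ha)

/-- In a product of two homogeneous elements of positive degree and total degree `n`, both factors
have degree below `n`, so only generators of smaller degree occur. -/
theorem mem_of_decomposable (hI : DirectSum.IsInternal 𝒱) {A : Subalgebra ℝ (FreeGCA 𝒱)} {n : ℕ}
    (h : ∀ m < n, ∀ v ∈ 𝒱 m, gen 𝒱 v ∈ A) {x : FreeGCA 𝒱} (hx : x ∈ grading 𝒱 n)
    (hx' : x ∈ decomposables (grading 𝒱)) : x ∈ A := by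
  have hA : ∀ m < n, grading 𝒱 m ≤ A.toSubmodule := fun m hm =>
    grading_le_of_gen_mem fun k hk => h k (hk.trans_lt hm)
  have key : decomposables (grading 𝒱) ≤ A.toSubmodule.comap (degProj hI n) := by
    refine decomposables_le_iff.2 fun i j hi hj x hx y hy => ?_
    rw [Submodule.mem_comap, degProj_of_mem hI (mul_mem_grading hx hy)]
    split_ifs with hn
    · exact A.mul_mem (hA i (by omega) hx) (hA j (by omega) hy)
    · exact zero_mem _
  have h1 := key hx'
  rwa [Submodule.mem_comap, degProj_self hI hx] at h1

/-! ### Word length -/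

/-- The elements of `S(V)` that are sums of products of at least `r` generators. -/
noncomputable def wordFiltration (hI : DirectSum.IsInternal 𝒱) (r : ℕ) :
    Submodule ℝ (FreeGCA 𝒱) where
  carrier := {x | ∀ k < r, (expHom hI (fun _ => 1) x).coeff k = 0}
  zero_mem' := by simp
  add_mem' := by
    intro x y hx hy k hk
    rw [map_add, Polynomial.coeff_add, hx k hk, hy k hk, add_zero]
  smul_mem' := by
    intro c x hx k hk
    rw [map_smul, Polynomial.coeff_smul, hx k hk, smul_zero]

theorem mul_mem_wordFiltration (hI : DirectSum.IsInternal 𝒱) {r s : ℕ} {x y : FreeGCA 𝒱}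
    (hx : x ∈ wordFiltration hI r) (hy : y ∈ wordFiltration hI s) :
    x * y ∈ wordFiltration hI (r + s) := by
  intro k hk
  rw [map_mul, Polynomial.coeff_mul]
  refine Finset.sum_eq_zero fun p hp => ?_
  rw [Finset.HasAntidiagonal.mem_antidiagonal] at hp
  -- Since `p.1 + p.2 < r + s`, either `p.1 < r` or `p.2 < s`.
  by_cases h : p.1 < r
  · rw [hx _ h, zero_mul]
  · rw [hy _ (by omega), mul_zero]

theorem augIdeal_le_wordFiltration (hI : DirectSum.IsInternal 𝒱) :
    augIdeal (grading 𝒱) ≤ wordFiltration hI 1 := by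
  refine iSup₂_le fun n hn => Submodule.span_le.2 ?_
  rintro _ ⟨l, hl, rfl⟩ k hk
  rw [expHom_list_prod, Polynomial.coeff_monomial, if_neg]
  rcases l with _ | ⟨a, l⟩
  · simp at hl
    omega
  · simp only [List.map_cons, List.sum_cons]
    omega

theorem decomposables_le_wordFiltration (hI : DirectSum.IsInternal 𝒱) :
    decomposables (grading 𝒱) ≤ wordFiltration hI 2 :=
  Submodule.mul_le.2 fun _ hx _ hy => mul_mem_wordFiltration hI
    (augIdeal_le_wordFiltration hI hx) (augIdeal_le_wordFiltration hI hy)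

theorem expHom_of_mem_genSpace (hI : DirectSum.IsInternal 𝒱) {x : FreeGCA 𝒱}
    (hx : x ∈ genSpace 𝒱) : expHom hI (fun _ => 1) x = Polynomial.monomial 1 x := by
  have h : genSpace 𝒱 ≤ LinearMap.eqLocus (expHom hI (fun _ => 1)).toLinearMap
      ((Polynomial.monomial (R := FreeGCA 𝒱) 1).restrictScalars ℝ) := by
    unfold genSpace
    rw [LinearMap.range_eq_map, ← hI.submodule_iSup_eq_top, Submodule.map_le_iff_le_comap]
    exact iSup_le fun n v hv => expHom_gen hI _ hv
  exact h hx

theorem eq_zero_of_mem_genSpace_of_decomposable (hI : DirectSum.IsInternal 𝒱) {x : FreeGCA 𝒱}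
    (hx : x ∈ genSpace 𝒱) (hx' : x ∈ decomposables (grading 𝒱)) : x = 0 := by
  have h := decomposables_le_wordFiltration hI hx' 1 one_lt_two
  rwa [expHom_of_mem_genSpace hI hx, Polynomial.coeff_monomial, if_pos rfl] at h

theorem eq_zero_of_mem_genSpace_mul (hI : DirectSum.IsInternal 𝒱) {x : FreeGCA 𝒱}
    (hx : x ∈ genSpace 𝒱 * genSpace 𝒱) (hx' : x ∈ wordFiltration hI 3) : x = 0 := by
  have key : genSpace 𝒱 * genSpace 𝒱 ≤ LinearMap.eqLocus (expHom hI (fun _ => 1)).toLinearMap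
      ((Polynomial.monomial (R := FreeGCA 𝒱) 2).restrictScalars ℝ) := by
    refine Submodule.mul_le.2 fun y hy z hz => ?_
    change expHom hI (fun _ => 1) (y * z) = Polynomial.monomial 2 (y * z)
    rw [map_mul, expHom_of_mem_genSpace hI hy, expHom_of_mem_genSpace hI hz,
      Polynomial.monomial_mul_monomial]
  have h := hx' 2 (by norm_num)
  have h' : expHom hI (fun _ => 1) x = Polynomial.monomial 2 x := key hx
  rwa [h', Polynomial.coeff_monomial, if_pos rfl] at h

/-! ### Sullivan algebras with quadratic differential -/

/-- By minimality `d` takes values of length at least 2, so each term of the Leibniz rule for a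
product of two elements of `M⁺` has length at least `2 + 1`. -/
theorem d_decomposables_mem_wordFiltration {d : FreeGCA 𝒱 →ₗ[ℝ] FreeGCA 𝒱} (hS : IsSullivan 𝒱 d)
    (hmin : IsMinimal 𝒱 d) {y : FreeGCA 𝒱} (hy : y ∈ decomposables (grading 𝒱)) :
    d y ∈ wordFiltration hS.isInternal 3 := by
  have key : decomposables (grading 𝒱) ≤ (wordFiltration hS.isInternal 3).comap d := by
    refine decomposables_le_iff.2 fun i j hi hj x hx y hy => ?_
    rw [Submodule.mem_comap, hS.leibniz i x hx]
    refine add_mem (mul_mem_wordFiltration _ (r := 2) (s := 1) ?_ ?_)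
      (Submodule.smul_mem _ _ (mul_mem_wordFiltration _ (r := 1) (s := 2) ?_ ?_))
    · exact decomposables_le_wordFiltration _ (hmin x)
    · exact augIdeal_le_wordFiltration _ (grading_le_augIdeal hj hy)
    · exact augIdeal_le_wordFiltration _ (grading_le_augIdeal hi hx)
    · exact decomposables_le_wordFiltration _ (hmin y)
  exact key hy

theorem ker_inf_genSpace {d : FreeGCA 𝒱 →ₗ[ℝ] FreeGCA 𝒱} (hS : IsSullivan 𝒱 d) :
    LinearMap.ker d ⊓ genSpace 𝒱 = cocycles (grading 𝒱) d ⊓ genSpace 𝒱 := by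
  unfold cocycles
  rw [inf_assoc, inf_eq_right.2 (genSpace_le_augIdeal hS.isInternal hS.positive)]

theorem genToPrim_bijective {d : FreeGCA 𝒱 →ₗ[ℝ] FreeGCA 𝒱} (hS : IsSullivan 𝒱 d)
    (hmin : IsMinimal 𝒱 d) (hq : IsQuadratic 𝒱 d) : Function.Bijective (genToPrim 𝒱 d) := by
  constructor
  · rw [injective_iff_map_eq_zero]
    rintro ⟨z, hz⟩ h
    have h' : (z : FreeGCA 𝒱) ∈ decomposables (grading 𝒱) :=
      (Submodule.Quotient.mk_eq_zero (decCocycles (grading 𝒱) d)).1 h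
    exact Subtype.ext (Subtype.ext (eq_zero_of_mem_genSpace_of_decomposable hS.isInternal hz h'))
  · intro t
    obtain ⟨z, rfl⟩ := Submodule.Quotient.mk_surjective _ t
    have hz := z.2.2
    rw [augIdeal_eq_genSpace_sup hS.isInternal hS.positive] at hz
    obtain ⟨v, hv, y, hy, hvy⟩ := Submodule.mem_sup.1 hz
    have hdz : d v = -d y := by
      rw [eq_neg_iff_add_eq_zero, ← map_add, hvy]
      exact z.2.1
    -- The element `dv = -dy` is purely of length 2 and also of length at least 3.
    have hdv : d v = 0 := by
      refine eq_zero_of_mem_genSpace_mul hS.isInternal (hq v hv) ?_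
      rw [hdz]
      exact neg_mem (d_decomposables_mem_wordFiltration hS hmin hy)
    have hvZ : v ∈ cocycles (grading 𝒱) d :=
      ⟨hdv, genSpace_le_augIdeal hS.isInternal hS.positive hv⟩
    refine ⟨⟨⟨v, hvZ⟩, hv⟩, (Submodule.Quotient.eq _).2 ?_⟩
    change v - (z : FreeGCA 𝒱) ∈ decomposables (grading 𝒱)
    rw [← hvy, sub_add_cancel_left]
    exact neg_mem hy

/-- `P(M)` embeds into the indecomposables `M⁺ / (M⁺)²`, which are the image of `V`. -/
theorem finiteDimensional_prim [FiniteDimensional ℝ V] {d : FreeGCA 𝒱 →ₗ[ℝ] FreeGCA 𝒱}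
    (hS : IsSullivan 𝒱 d) : FiniteDimensional ℝ (Prim (grading 𝒱) d) := by
  let D := decomposables (grading 𝒱)
  have hfin : FiniteDimensional ℝ ((genSpace 𝒱).map D.mkQ) := by
    unfold genSpace
    infer_instance
  let f : Prim (grading 𝒱) d →ₗ[ℝ] FreeGCA 𝒱 ⧸ D :=
    (decCocycles (grading 𝒱) d).mapQ D (cocycles (grading 𝒱) d).subtype le_rfl
  have hf : Function.Injective f := by
    rw [← LinearMap.ker_eq_bot]
    exact Submodule.ker_liftQ_eq_bot _ _ _ (by
      rw [LinearMap.ker_comp, Submodule.ker_mkQ]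
      exact le_rfl)
  have hr : ∀ t, f t ∈ (genSpace 𝒱).map D.mkQ := by
    intro t
    obtain ⟨z, rfl⟩ := Submodule.Quotient.mk_surjective _ t
    have hz := z.2.2
    rw [augIdeal_eq_genSpace_sup hS.isInternal hS.positive] at hz
    obtain ⟨v, hv, y, hy, hvy⟩ := Submodule.mem_sup.1 hz
    refine ⟨v, hv, (Submodule.Quotient.eq _).2 ?_⟩
    change v - (z : FreeGCA 𝒱) ∈ D
    rw [← hvy, sub_add_cancel_left]
    exact neg_mem hy
  exact Module.Finite.of_injective (f.codRestrict _ hr)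
    (fun a b h => hf (congrArg Subtype.val h))

/-! ### Subalgebras of a minimal Sullivan algebra -/

/-- The only part of a degree `n + 1` element that could involve generators of degree `n + 1` is its
linear part, by positivity of degrees. For a decomposable element the linear part vanishes. The
induction over the subalgebra therefore carries an uncontrolled summand from `V` in degree `n + 1`,
which is removed at the end. -/
theorem mem_of_mem_adjoin (hI : DirectSum.IsInternal 𝒱) (h0 : 𝒱 0 = ⊥)
    {A : Subalgebra ℝ (FreeGCA 𝒱)} {n : ℕ} {F : Submodule ℝ V} (hF : F = ⨆ n, F ⊓ 𝒱 n)
    (hA : ∀ m ≤ n, ∀ v ∈ F ⊓ 𝒱 m, gen 𝒱 v ∈ A) {x : FreeGCA 𝒱}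
    (hx : x ∈ Algebra.adjoin ℝ (gen 𝒱 '' (F : Set V))) (hx' : x ∈ decomposables (grading 𝒱))
    (hxn : x ∈ grading 𝒱 (n + 1)) : x ∈ A := by
  have key : (∀ m ≤ n, degProj hI m x ∈ A) ∧
      degProj hI (n + 1) x ∈ (A.toSubmodule ⊓ decomposables (grading 𝒱)) ⊔ genSpace 𝒱 := by
    clear hx' hxn
    induction hx using Algebra.adjoin_induction with
    | mem x hx =>
      obtain ⟨v, hv, rfl⟩ := hx
      constructor
      · intro m hm
        obtain ⟨w, hw, hw'⟩ := degProj_gen_mem hI hF hv m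
        rw [← hw']
        exact hA m hm w hw
      · obtain ⟨w, hw, hw'⟩ := degProj_gen_mem hI hF hv (n + 1)
        rw [← hw']
        exact Submodule.mem_sup_right ⟨w, rfl⟩
    | algebraMap r =>
      have h : ∀ m, degProj hI m (algebraMap ℝ (FreeGCA 𝒱) r) =
          if 0 = m then algebraMap ℝ (FreeGCA 𝒱) r else 0 := by
        intro m
        apply degProj_of_mem
        rw [Algebra.algebraMap_eq_smul_one]
        exact Submodule.smul_mem _ _ one_mem_grading
      constructor
      · intro m _
        rw [h]
        split_ifs
        · exact A.algebraMap_mem r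
        · exact zero_mem _
      · rw [h, if_neg (by omega)]
        exact zero_mem _
    | add x y _ _ hx hy =>
      simp only [map_add]
      exact ⟨fun m hm => add_mem (hx.1 m hm) (hy.1 m hm), add_mem hx.2 hy.2⟩
    | mul x y _ _ hx hy =>
      simp only [degProj_mul]
      constructor
      · intro m hm
        refine sum_mem fun p hp => ?_
        rw [Finset.HasAntidiagonal.mem_antidiagonal] at hp
        exact mul_mem (hx.1 _ (by omega)) (hy.1 _ (by omega))
      · refine sum_mem fun p hp => ?_
        obtain ⟨i, j⟩ := p
        rw [Finset.HasAntidiagonal.mem_antidiagonal] at hp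
        dsimp only at hp ⊢
        -- A factor of degree `0` is a scalar because `V⁰ = 0`. In the remaining terms both factors
        -- have degree between `1` and `n`.
        rcases Nat.eq_zero_or_pos i with rfl | hi
        · obtain ⟨r, hr⟩ := Algebra.mem_bot.1 (grading_zero_le h0 (degProj_mem hI 0 x))
          rw [← hr, ← Algebra.smul_def, show j = n + 1 by omega]
          exact Submodule.smul_mem _ _ hy.2
        rcases Nat.eq_zero_or_pos j with rfl | hj
        · obtain ⟨r, hr⟩ := Algebra.mem_bot.1 (grading_zero_le h0 (degProj_mem hI 0 y))
          rw [← hr, ← Algebra.commutes, ← Algebra.smul_def, show i = n + 1 by omega]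
          exact Submodule.smul_mem _ _ hx.2
        exact Submodule.mem_sup_left ⟨A.mul_mem (hx.1 _ (by omega)) (hy.1 _ (by omega)),
          Submodule.mul_mem_mul (grading_le_augIdeal hi (degProj_mem hI _ _))
            (grading_le_augIdeal hj (degProj_mem hI _ _))⟩
  obtain ⟨a, ha, w, hw, haw⟩ := Submodule.mem_sup.1 key.2
  rw [degProj_self hI hxn] at haw
  have hw0 : w = 0 := by
    refine eq_zero_of_mem_genSpace_of_decomposable hI hw ?_
    rw [← add_sub_cancel_left a w, haw]
    exact sub_mem hx' ha.2
  rw [← haw, hw0, add_zero]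
  exact ha.1

/-- A subalgebra `A` of a minimal Sullivan algebra is the whole algebra if, degree by degree, it
contains every generator whose differential it contains. -/
theorem eq_top_of_gen_mem {d : FreeGCA 𝒱 →ₗ[ℝ] FreeGCA 𝒱} (hS : IsSullivan 𝒱 d)
    (hmin : IsMinimal 𝒱 d) (A : Subalgebra ℝ (FreeGCA 𝒱))
    (hA : ∀ n, (∀ m < n, ∀ v ∈ 𝒱 m, gen 𝒱 v ∈ A) →
      ∀ v ∈ 𝒱 n, d (gen 𝒱 v) ∈ A → gen 𝒱 v ∈ A) : A = ⊤ := by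
  obtain ⟨F, -, hgr, hex, hF0, hFs⟩ := hS.nilpotence
  have key : ∀ n, ∀ v ∈ 𝒱 n, gen 𝒱 v ∈ A := by
    intro n
    induction n using Nat.strong_induction_on with
    | _ n ih =>
      -- Inner induction along the filtration: the differential of `v ∈ V(k+1)` of degree `n`
      -- involves only generators of `V(k)` of degree at most `n`. Those of degree `n` are covered
      -- by `ihk`, the others by `ih`.
      have hk : ∀ k, ∀ v ∈ F k ⊓ 𝒱 n, gen 𝒱 v ∈ A := by
        intro k
        induction k with
        | zero =>
          intro v hv
          refine hA n ih v hv.2 ?_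
          rw [hF0 v hv.1]
          exact zero_mem _
        | succ k ihk =>
          intro v hv
          refine hA n ih v hv.2 (mem_of_mem_adjoin hS.isInternal hS.positive (hgr k) (n := n)
            (fun m hm w hw => ?_) (hFs k v hv.1) (hmin _)
            (hS.degree n _ (gen_mem_grading hv.2)))
          rcases hm.lt_or_eq with h | rfl
          · exact ih m h w hw.2
          · exact ihk w hw
      intro v hv
      obtain ⟨k, hk'⟩ := hex v
      exact hk k v ⟨hk', hv⟩
  have hgen : genSpace 𝒱 ≤ A.toSubmodule := by
    unfold genSpace
    rw [LinearMap.range_eq_map, ← hS.isInternal.submodule_iSup_eq_top,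
      Submodule.map_le_iff_le_comap]
    exact iSup_le fun n v hv => key n v hv
  rw [← top_le_iff, ← adjoin_range_gen]
  exact Algebra.adjoin_le (by rintro _ ⟨v, rfl⟩; exact hgen ⟨v, rfl⟩)

end FreeAlgebra

section Diagonalizable

variable {H : Type v} [CommRing H] [HopfAlgebra ℝ H]

/-! ### Diagonalizable groups -/

variable (H) in
/-- The group with coordinate ring `H` is diagonalizable: its characters span `H`. -/
def IsDiagonalizable : Prop :=
  Submodule.span ℝ (Set.range (GroupLike.val : Character H → H)) = ⊤

/-- The characters form a basis of the coordinate ring. -/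
noncomputable def charBasis (hH : IsDiagonalizable H) : Module.Basis (Character H) ℝ H :=
  Module.Basis.mk linearIndep_groupLikeVal (top_le_iff.2 hH)

theorem charBasis_apply (hH : IsDiagonalizable H) (χ : Character H) :
    charBasis hH χ = χ.val :=
  Module.Basis.mk_apply _ _ χ

theorem algHom_ext_of_character (hH : IsDiagonalizable H) {B : Type*} [Ring B] [Algebra ℝ B]
    {f g : H →ₐ[ℝ] B} (h : ∀ χ : Character H, f χ.val = g χ.val) : f = g :=
  AlgHom.toLinearMap_injective ((charBasis hH).ext fun χ => by
    rw [charBasis_apply]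
    exact h χ)

/-- The coordinate ring of a diagonalizable group is the group algebra of its characters. -/
noncomputable def groupAlgebraEquiv (hH : IsDiagonalizable H) :
    MonoidAlgebra ℝ (Character H) ≃ₐ[ℝ] H :=
  AlgEquiv.ofBijective (MonoidAlgebra.lift ℝ H (Character H) (GroupLike.valMonoidHom ℝ H)) (by
    have h : (MonoidAlgebra.lift ℝ H (Character H) (GroupLike.valMonoidHom ℝ H)).toLinearMap =
        ((MonoidAlgebra.basis (Character H) ℝ).equiv (charBasis hH)
          (Equiv.refl _)).toLinearMap := by
      refine (MonoidAlgebra.basis (Character H) ℝ).ext fun χ => ?_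
      rw [LinearEquiv.coe_coe, Module.Basis.equiv_apply, charBasis_apply,
        MonoidAlgebra.basis_apply, AlgHom.toLinearMap_apply, MonoidAlgebra.lift_single, one_smul]
      rfl
    have h' := ((MonoidAlgebra.basis (Character H) ℝ).equiv (charBasis hH)
          (Equiv.refl _)).bijective
    exact (congrArg (fun f : MonoidAlgebra ℝ (Character H) →ₗ[ℝ] H => Function.Bijective f)
      h).mpr h')

theorem groupAlgebraEquiv_of (hH : IsDiagonalizable H) (χ : Character H) :
    groupAlgebraEquiv hH (MonoidAlgebra.of ℝ _ χ) = χ.val :=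
  MonoidAlgebra.lift_of _ _

theorem one_apply_character {R : Type v} [CommRing R] [Algebra ℝ R] (χ : Character H) :
    (1 : Points H R).ofConv χ.val = 1 := by
  refine (AlgHom.convOne_apply χ.val).trans ?_
  rw [χ.2.counit_eq_one, map_one]

theorem mul_apply_character {R : Type v} [CommRing R] [Algebra ℝ R] (g h : Points H R)
    (χ : Character H) : (g * h).ofConv χ.val = g.ofConv χ.val * h.ofConv χ.val := by
  refine (AlgHom.convMul_apply g h χ.val).trans ?_
  rw [χ.2.comul_eq_tmul_self, Algebra.TensorProduct.lift_tmul]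

/-- A proper subgroup of the character group is killed by a nontrivial point. -/
theorem exists_point_ne_one (hH : IsDiagonalizable H) (L : Subgroup (Character H)) (hL : L ≠ ⊤) :
    ∃ (R : Type v) (_ : CommRing R) (_ : Algebra ℝ R) (g : Points H R),
      g ≠ 1 ∧ ∀ χ ∈ L, g.ofConv χ.val = 1 := by
  -- The projection `ℝ[𝔛(T)] → ℝ[𝔛(T)/L]` is the generic point of the subgroup of `T` on which `L`
  -- is trivial.
  let f : H →ₐ[ℝ] MonoidAlgebra ℝ (Character H ⧸ L) :=
    (MonoidAlgebra.lift ℝ _ _ ((MonoidAlgebra.of ℝ (Character H ⧸ L)).comp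
      (QuotientGroup.mk' L))).comp (groupAlgebraEquiv hH).symm.toAlgHom
  have hf : ∀ χ : Character H, f χ.val = MonoidAlgebra.of ℝ _ (QuotientGroup.mk' L χ) := by
    intro χ
    change MonoidAlgebra.lift ℝ _ _ _ ((groupAlgebraEquiv hH).symm χ.val) = _
    rw [← groupAlgebraEquiv_of hH χ, AlgEquiv.symm_apply_apply, MonoidAlgebra.lift_of]
    rfl
  refine ⟨_, inferInstance, inferInstance, WithConv.toConv f, fun h => hL ?_, fun χ hχ => ?_⟩
  · rw [Subgroup.eq_top_iff']
    intro χ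
    have h1 : f χ.val = 1 := by
      have := one_apply_character (R := MonoidAlgebra ℝ (Character H ⧸ L)) χ
      rwa [← h] at this
    rw [hf, ← map_one (MonoidAlgebra.of ℝ (Character H ⧸ L))] at h1
    exact (QuotientGroup.eq_one_iff χ).1 (MonoidAlgebra.of_injective h1)
  · change f χ.val = 1
    rw [hf, ← map_one (MonoidAlgebra.of ℝ (Character H ⧸ L))]
    congr 1
    exact (QuotientGroup.eq_one_iff χ).2 hχ

/-- The group-like elements of the Laurent polynomial ring are exactly its monomials, and these span
it. -/
theorem IsSplitTorus.exists_character {n : ℕ} (h : IsSplitTorus H n) :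
    ∃ f : Multiplicative (Fin n → ℤ) →* Character H, Function.Bijective f ∧
      Submodule.span ℝ (Set.range fun m => (f m).val) = ⊤ := by
  obtain ⟨e⟩ := h
  let f : Multiplicative (Fin n → ℤ) →* Character H :=
    { toFun := fun m => ⟨e.symm (AddMonoidAlgebra.of ℝ _ m),
        IsGroupLikeElem.map e.symm (AddMonoidAlgebra.isGroupLikeElem_of _)⟩
      map_one' := GroupLike.val_injective (by
        change e.symm (AddMonoidAlgebra.of ℝ _ 1) = 1
        rw [map_one, map_one])
      map_mul' := fun a b => GroupLike.val_injective (by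
        change e.symm (AddMonoidAlgebra.of ℝ _ (a * b)) = _ * _
        rw [map_mul, map_mul]) }
  refine ⟨f, ⟨fun a b hab => ?_, fun χ => ?_⟩, ?_⟩
  · exact AddMonoidAlgebra.of_injective (e.symm.injective (congrArg GroupLike.val hab))
  · obtain ⟨m, hm⟩ := AddMonoidAlgebra.isGroupLikeElem_iff_mem_range_of.1
      (IsGroupLikeElem.map e χ.2)
    refine ⟨m, GroupLike.val_injective ?_⟩
    change e.symm (AddMonoidAlgebra.of ℝ _ m) = _
    rw [hm]
    exact e.symm_apply_apply _
  · have h1 : (Set.range fun m => (f m).val) =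
        (e.symm : AddMonoidAlgebra ℝ (Fin n → ℤ) ≃ₐ[ℝ] H).toLinearMap ''
          (Set.range (AddMonoidAlgebra.of ℝ (Fin n → ℤ))) := by
      rw [← Set.range_comp]
      rfl
    have h2 : Set.range (AddMonoidAlgebra.of ℝ (Fin n → ℤ)) =
        Set.range (AddMonoidAlgebra.basis (Fin n → ℤ) ℝ) := by
      congr 1
    rw [h1, Submodule.span_image, h2, Module.Basis.span_eq, Submodule.map_top]
    exact LinearMap.range_eq_top.2 e.symm.surjective

theorem IsSplitTorus.isDiagonalizable {n : ℕ} (h : IsSplitTorus H n) : IsDiagonalizable H := by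
  obtain ⟨f, -, hf⟩ := h.exists_character
  refine top_le_iff.1 (hf.ge.trans (Submodule.span_mono ?_))
  rintro _ ⟨m, rfl⟩
  exact ⟨f m, rfl⟩

theorem IsSplitTorus.character_equiv {n : ℕ} (h : IsSplitTorus H n) :
    Nonempty (Multiplicative (Fin n → ℤ) ≃* Character H) := by
  obtain ⟨f, hf, -⟩ := h.exists_character
  exact ⟨MulEquiv.ofBijective f hf⟩

end Diagonalizable

/-! ### Tensor products over a field and contraction of a factor -/

section TensorLemmas

theorem eq_zero_or_eq_zero_of_tmul {R : Type*} [CommRing R] [Algebra ℝ R] {W : Type*}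
    [AddCommGroup W] [Module ℝ W] {r : R} {w : W} (h : r ⊗ₜ[ℝ] w = 0) : r = 0 ∨ w = 0 := by
  by_contra! hw
  obtain ⟨f, hf⟩ := not_forall.1 (mt (Module.forall_dual_apply_eq_zero_iff ℝ w).1 hw.2)
  have h1 := congrArg (TensorProduct.rid ℝ R ∘ f.lTensor R) h
  simp only [Function.comp_apply, LinearMap.lTensor_tmul, TensorProduct.rid_tmul, map_zero,
    smul_eq_zero] at h1
  exact h1.elim hf hw.1

/-- Weight components are contractions of the coaction in the factor `H`, so this transfers
properties of the coaction to them. -/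
theorem lid_rTensor_lTensor {U W W' : Type*} [AddCommGroup U] [Module ℝ U] [AddCommGroup W]
    [Module ℝ W] [AddCommGroup W'] [Module ℝ W'] (c : U →ₗ[ℝ] ℝ) (f : W →ₗ[ℝ] W')
    (t : U ⊗[ℝ] W) : TensorProduct.lid ℝ W' (c.rTensor W' (f.lTensor U t)) =
      f (TensorProduct.lid ℝ W (c.rTensor W t)) := by
  induction t with
  | zero => simp only [map_zero]
  | add x y hx hy => simp only [map_add, hx, hy]
  | tmul x y => simp

theorem finsuppSum_single_smul {X W N : Type*} [AddCommGroup W] [AddCommGroup N] [Module ℝ N]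
    (f : X →₀ W) (β : X) (G : X → W → N) (hG : G β 0 = 0) :
    (f.sum fun χ y => (Finsupp.single χ (1 : ℝ) β) • G χ y) = G β (f β) := by
  classical
  rw [Finsupp.sum, Finset.sum_eq_single β]
  · rw [Finsupp.single_eq_same, one_smul]
  · intro χ _ hχ
    rw [Finsupp.single_eq_of_ne' hχ, zero_smul]
  · intro h
    rw [Finsupp.notMem_support_iff.1 h, hG, smul_zero]

end TensorLemmas

theorem hopfAlgebra_nontrivial (H : Type v) [CommRing H] [HopfAlgebra ℝ H] : Nontrivial H :=
  (Bialgebra.counitAlgHom ℝ H).toRingHom.domain_nontrivial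

/-! ### Independence of weight spaces -/

section WeightSpaces

variable {H : Type v} [CommRing H] [HopfAlgebra ℝ H] {W : Type*} [AddCommGroup W] [Module ℝ W]
  {ρ : ∀ (R : Type v) [CommRing R] [Algebra ℝ R], Points H R → Module.End R (R ⊗[ℝ] W)}

theorem eq_of_mem_weightSpace_of_eq_sum (hH : IsDiagonalizable H) {s : Finset (Character H)}
    {u : Character H → W} (hu : ∀ ψ ∈ s, u ψ ∈ weightSpace ρ ψ) {χ : Character H}
    (hs : ∑ ψ ∈ s, u ψ ∈ weightSpace ρ χ) (hχ : χ ∉ s → u χ = 0) : ∑ ψ ∈ s, u ψ = u χ := by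
  classical
  -- At the generic point each `u ψ` is multiplied by the basis vector `ψ` of `H`. Comparing the
  -- coefficients of `χ` isolates `u χ`.
  have h1 := hs H (WithConv.toConv (AlgHom.id ℝ H))
  rw [TensorProduct.tmul_sum, map_sum,
    Finset.sum_congr rfl fun ψ hψ => hu ψ hψ H (WithConv.toConv (AlgHom.id ℝ H))] at h1
  have h2 := congrArg (fun t => TensorProduct.lid ℝ W (((charBasis hH).coord χ).rTensor W t)) h1
  simp only [AlgHom.id_apply, map_sum, LinearMap.rTensor_tmul, TensorProduct.lid_tmul,
    ← charBasis_apply hH, Module.Basis.coord_apply, Module.Basis.repr_self,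
    Finsupp.single_eq_same, one_smul] at h2
  rw [← h2, Finset.sum_eq_single χ]
  · rw [Finsupp.single_eq_same, one_smul]
  · intro ψ _ hψ
    rw [Finsupp.single_eq_of_ne' hψ, zero_smul]
  · intro h
    rw [hχ h, smul_zero]

theorem linearIndependent_of_mem_weightSpace (hH : IsDiagonalizable H) {w : weights ρ → W}
    (hw : ∀ χ, w χ ∈ weightSpace ρ χ.1) (hw0 : ∀ χ, w χ ≠ 0) : LinearIndependent ℝ w := by
  classical
  rw [linearIndependent_iff']
  intro s c hc χ hχ
  -- The family `c • w` on `s`, extended by zero to all characters.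
  let u : Character H → W := fun ψ => if h : ψ ∈ weights ρ then
    (if (⟨ψ, h⟩ : weights ρ) ∈ s then c ⟨ψ, h⟩ • w ⟨ψ, h⟩ else 0) else 0
  have hu : ∀ ψ : weights ρ, ψ ∈ s → u ψ = c ψ • w ψ := by
    intro ψ hψ
    simp only [u, dif_pos ψ.2, if_pos hψ, Subtype.coe_eta]
  have hsum : ∑ ψ ∈ s.map ⟨Subtype.val, Subtype.val_injective⟩, u ψ = 0 := by
    rw [Finset.sum_map, ← hc]
    exact Finset.sum_congr rfl fun ψ hψ => hu ψ hψ
  have h := eq_of_mem_weightSpace_of_eq_sum hH (ρ := ρ) (χ := χ)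
    (s := s.map ⟨Subtype.val, Subtype.val_injective⟩) (u := u) (fun ψ hψ => ?_)
    (by rw [hsum]; exact zero_mem _) (fun h => absurd (Finset.mem_map_of_mem _ hχ) h)
  · rw [hsum, hu χ hχ] at h
    exact (smul_eq_zero.1 h.symm).resolve_right (hw0 χ)
  · obtain ⟨φ, hφ, rfl⟩ := Finset.mem_map.1 hψ
    change u φ ∈ weightSpace ρ φ.1
    rw [hu φ hφ]
    exact Submodule.smul_mem _ _ (hw φ)

theorem card_weights_le [FiniteDimensional ℝ W] (hH : IsDiagonalizable H) :
    (weights ρ).Finite ∧ (weights ρ).ncard ≤ Module.finrank ℝ W := by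
  have hex : ∀ χ : weights ρ, ∃ w ∈ weightSpace ρ χ.1, w ≠ 0 :=
    fun χ => Submodule.exists_mem_ne_zero_of_ne_bot χ.2
  choose w hw hw0 using hex
  have hli := linearIndependent_of_mem_weightSpace hH hw hw0
  have hfin : Finite (weights ρ) := hli.finite
  have := Fintype.ofFinite (weights ρ)
  refine ⟨Set.toFinite _, ?_⟩
  rw [← Nat.card_coe_set_eq, Nat.card_eq_fintype_card]
  exact hli.fintype_card_le_finrank

end WeightSpaces

namespace Action

variable {H : Type v} [CommRing H] [HopfAlgebra ℝ H] {M : Type u} [Ring M] [Algebra ℝ M]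
  {𝒜 : ℕ → Submodule ℝ M} {d : M →ₗ[ℝ] M}

/-! ### The weight decomposition of an action of a diagonalizable group -/

/-- The coaction `M → H ⊗ M`, the action of the generic point. -/
noncomputable def coaction (ρ : Action H 𝒜 d) : M →ₗ[ℝ] H ⊗[ℝ] M :=
  (ρ.onM H (WithConv.toConv (AlgHom.id ℝ H))).restrictScalars ℝ ∘ₗ TensorProduct.mk ℝ H M 1

/-- Yoneda: every point `g : H → R` is the image of the generic point `id : H → H`, so naturality
computes its action from the coaction. -/
theorem onM_one_tmul (ρ : Action H 𝒜 d) {R : Type v} [CommRing R] [Algebra ℝ R] (g : Points H R)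
    (x : M) : ρ.onM R g (1 ⊗ₜ x) = g.ofConv.toLinearMap.rTensor M (ρ.coaction x) := by
  have h := ρ.natural H R g.ofConv (WithConv.toConv (AlgHom.id ℝ H)) (1 ⊗ₜ x)
  rw [LinearMap.rTensor_tmul, AlgHom.toLinearMap_apply, map_one] at h
  exact h

open scoped Classical in
/-- The weight components of a vector. -/
noncomputable def weightComp (hH : IsDiagonalizable H) (ρ : Action H 𝒜 d) :
    M →ₗ[ℝ] (Character H →₀ M) :=
  (TensorProduct.equivFinsuppOfBasisLeft (charBasis hH)).toLinearMap ∘ₗ ρ.coaction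

theorem coaction_eq_sum (hH : IsDiagonalizable H) (ρ : Action H 𝒜 d) (x : M) :
    ρ.coaction x = (weightComp hH ρ x).sum fun χ y => χ.val ⊗ₜ[ℝ] y := by
  classical
  have h := TensorProduct.equivFinsuppOfBasisLeft_symm_apply (charBasis hH) (weightComp hH ρ x)
  simp only [charBasis_apply] at h
  rw [← h, weightComp, LinearMap.comp_apply, LinearEquiv.coe_coe, LinearEquiv.symm_apply_apply]

theorem onM_one_tmul_eq_sum (hH : IsDiagonalizable H) (ρ : Action H 𝒜 d) {R : Type v} [CommRing R]
    [Algebra ℝ R] (g : Points H R) (x : M) :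
    ρ.onM R g (1 ⊗ₜ x) = (weightComp hH ρ x).sum fun χ y => g.ofConv χ.val ⊗ₜ[ℝ] y := by
  rw [onM_one_tmul, coaction_eq_sum hH, map_finsuppSum]
  rfl

/-- Evaluation at the identity of `T`, where every character has the value `1`. -/
theorem sum_weightComp (hH : IsDiagonalizable H) (ρ : Action H 𝒜 d) (x : M) :
    ((weightComp hH ρ x).sum fun _ y => y) = x := by
  have := hopfAlgebra_nontrivial H
  have h := onM_one_tmul_eq_sum hH ρ (1 : Points H H) x
  simp only [one_apply_character] at h
  have h1 : ρ.onM H 1 (1 ⊗ₜ x) = 1 ⊗ₜ x := by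
    unfold onM
    rw [map_one]
    rfl
  rw [h1] at h
  have h2 : ((weightComp hH ρ x).sum fun χ y => (1 : H) ⊗ₜ[ℝ] y) =
      1 ⊗ₜ[ℝ] ((weightComp hH ρ x).sum fun _ y => y) := by
    simp only [Finsupp.sum, TensorProduct.tmul_sum]
  rw [h2] at h
  rw [← sub_eq_zero, ← TensorProduct.tmul_sub] at h
  exact (sub_eq_zero.1 ((eq_zero_or_eq_zero_of_tmul h).resolve_left one_ne_zero)).symm

theorem weightComp_apply (hH : IsDiagonalizable H) (ρ : Action H 𝒜 d) (x : M) (χ : Character H) :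
    weightComp hH ρ x χ =
      TensorProduct.lid ℝ M (((charBasis hH).coord χ).rTensor M (ρ.coaction x)) := by
  classical
  exact TensorProduct.equivFinsuppOfBasisLeft_apply _ _ _

theorem weightComp_of_coaction (hH : IsDiagonalizable H) (ρ : Action H 𝒜 d) {x : M}
    {χ : Character H} (h : ρ.coaction x = χ.val ⊗ₜ x) :
    weightComp hH ρ x = Finsupp.single χ x := by
  classical
  ext ψ
  rw [weightComp_apply, h, LinearMap.rTensor_tmul, TensorProduct.lid_tmul, ← charBasis_apply hH,
    Module.Basis.coord_apply, Module.Basis.repr_self, Finsupp.single_apply, Finsupp.single_apply,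
    ite_smul, one_smul, zero_smul]

theorem mem_weightSpace_iff (hH : IsDiagonalizable H) (ρ : Action H 𝒜 d) (x : M)
    (χ : Character H) :
    x ∈ weightSpace ρ.onM χ ↔ weightComp hH ρ x = Finsupp.single χ x := by
  constructor
  · intro h
    exact weightComp_of_coaction hH ρ (h H (WithConv.toConv (AlgHom.id ℝ H)))
  · intro h R _ _ g
    rw [onM_one_tmul_eq_sum hH, h]
    exact Finsupp.sum_single_index (TensorProduct.tmul_zero _ _)

/-- The product of the two coordinate points of `T × T` is the multiplication map, that is, the
comultiplication of `H`. -/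
theorem includeLeft_mul_includeRight :
    (WithConv.toConv (Algebra.TensorProduct.includeLeft : H →ₐ[ℝ] H ⊗[ℝ] H) *
      WithConv.toConv (Algebra.TensorProduct.includeRight : H →ₐ[ℝ] H ⊗[ℝ] H) :
      Points H (H ⊗[ℝ] H)) = WithConv.toConv (Bialgebra.comulAlgHom ℝ H) := by
  have h : (Algebra.TensorProduct.lmul' ℝ (S := H ⊗[ℝ] H)).comp (Algebra.TensorProduct.map
      (Algebra.TensorProduct.includeLeft : H →ₐ[ℝ] H ⊗[ℝ] H)
      (Algebra.TensorProduct.includeRight : H →ₐ[ℝ] H ⊗[ℝ] H)) = AlgHom.id ℝ _ := by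
    ext <;> simp
  rw [AlgHom.convMul_def]
  change WithConv.toConv (AlgHom.comp _ (AlgHom.comp _ _)) = _
  rw [← AlgHom.comp_assoc, h, AlgHom.id_comp]

/-- Coassociativity. The product of two independent generic points sends `x` to `∑ χ ⊗ χ ⊗ x_χ`;
letting them act one after the other gives the coaction of each `x_χ`, with `χ` in the second
factor. The coefficient of `β` in that factor (`K`) yields the two sides. -/
theorem coaction_weightComp (hH : IsDiagonalizable H) (ρ : Action H 𝒜 d) (x : M)
    (β : Character H) :
    ρ.coaction (weightComp hH ρ x β) = β.val ⊗ₜ weightComp hH ρ x β := by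
  let i₁ : Points H (H ⊗[ℝ] H) := WithConv.toConv Algebra.TensorProduct.includeLeft
  let i₂ : Points H (H ⊗[ℝ] H) := WithConv.toConv Algebra.TensorProduct.includeRight
  let K : (H ⊗[ℝ] H) ⊗[ℝ] M →ₗ[ℝ] H ⊗[ℝ] M :=
    ((TensorProduct.rid ℝ H).toLinearMap ∘ₗ ((charBasis hH).coord β).lTensor H).rTensor M
  have hcoord : ∀ χ : Character H, (charBasis hH).coord β χ.val = Finsupp.single χ (1 : ℝ) β := by
    intro χ
    rw [← charBasis_apply hH, Module.Basis.coord_apply, Module.Basis.repr_self]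
  have hA : K (ρ.onM _ (i₁ * i₂) (1 ⊗ₜ x)) = β.val ⊗ₜ weightComp hH ρ x β := by
    rw [onM_one_tmul_eq_sum hH, map_finsuppSum]
    refine Eq.trans ?_ (finsuppSum_single_smul (weightComp hH ρ x) β (fun χ y => χ.val ⊗ₜ[ℝ] y)
      (TensorProduct.tmul_zero _ _))
    refine Finsupp.sum_congr fun χ _ => ?_
    have h : (i₁ * i₂).ofConv χ.val = χ.val ⊗ₜ[ℝ] χ.val := by
      rw [includeLeft_mul_includeRight]
      exact χ.2.comul_eq_tmul_self
    rw [h]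
    simp only [K, LinearMap.rTensor_tmul, LinearMap.comp_apply, LinearMap.lTensor_tmul, hcoord,
      LinearEquiv.coe_coe, TensorProduct.rid_tmul, TensorProduct.smul_tmul']
  have hK : ∀ (χ : Character H) (t : H ⊗[ℝ] M),
      K (((1 : H) ⊗ₜ[ℝ] χ.val) • (i₁.ofConv.toLinearMap.rTensor M t)) =
        (Finsupp.single χ (1 : ℝ) β) • t := by
    intro χ t
    induction t with
    | zero => simp only [map_zero, smul_zero]
    | add t t' ht ht' => simp only [map_add, smul_add, ht, ht']
    | tmul h m =>
      simp only [i₁, K, LinearMap.rTensor_tmul, AlgHom.toLinearMap_apply,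
        Algebra.TensorProduct.includeLeft_apply, TensorProduct.smul_tmul', smul_eq_mul,
        Algebra.TensorProduct.tmul_mul_tmul, one_mul, mul_one, LinearMap.comp_apply,
        LinearMap.lTensor_tmul, hcoord, LinearEquiv.coe_coe, TensorProduct.rid_tmul]
  have hB : K (ρ.onM _ (i₁ * i₂) (1 ⊗ₜ x)) = ρ.coaction (weightComp hH ρ x β) := by
    have h1 : ρ.onM _ (i₁ * i₂) (1 ⊗ₜ x) = ρ.onM _ i₁ (ρ.onM _ i₂ (1 ⊗ₜ x)) := by
      unfold onM
      rw [map_mul]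
      rfl
    rw [h1, onM_one_tmul_eq_sum hH ρ i₂, map_finsuppSum, map_finsuppSum]
    refine Eq.trans ?_ (finsuppSum_single_smul (weightComp hH ρ x) β (fun _ y => ρ.coaction y)
      (map_zero _))
    refine Finsupp.sum_congr fun χ _ => ?_
    rw [← hK, ← onM_one_tmul, ← LinearMap.map_smul, TensorProduct.smul_tmul', smul_eq_mul, mul_one]
    rfl
  rw [← hB, hA]

theorem weightComp_mem_weightSpace (hH : IsDiagonalizable H) (ρ : Action H 𝒜 d) (x : M)
    (χ : Character H) : weightComp hH ρ x χ ∈ weightSpace ρ.onM χ :=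
  (mem_weightSpace_iff hH ρ _ χ).2 (weightComp_of_coaction hH ρ (coaction_weightComp hH ρ x χ))

theorem weightComp_d (hH : IsDiagonalizable H) (ρ : Action H 𝒜 d) (x : M) (χ : Character H) :
    weightComp hH ρ (d x) χ = d (weightComp hH ρ x χ) := by
  have h : ρ.coaction (d x) = d.lTensor H (ρ.coaction x) :=
    (ρ.hom H (WithConv.toConv (AlgHom.id ℝ H))).2.2 (1 ⊗ₜ x)
  rw [weightComp_apply, weightComp_apply, h, lid_rTensor_lTensor]

/-- Stability of `H ⊗ N` puts the coaction of `x` in `H ⊗ N`, and contracting the factor `H` lands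
in `N`. -/
theorem weightComp_mem (hH : IsDiagonalizable H) (ρ : Action H 𝒜 d) {N : Submodule ℝ M}
    (hN : ∀ f : AutPoints H 𝒜 d, ∀ x ∈ N.baseChange H, f.1.toLinearMap x ∈ N.baseChange H)
    {x : M} (hx : x ∈ N) (χ : Character H) : weightComp hH ρ x χ ∈ N := by
  obtain ⟨t, ht⟩ : ρ.coaction x ∈ N.baseChange H :=
    hN (ρ.hom H (WithConv.toConv (AlgHom.id ℝ H))) _ (Submodule.tmul_mem_baseChange_of_mem 1 hx)
  have h : N.subtype.lTensor H t = ρ.coaction x := ht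
  rw [weightComp_apply, ← h, lid_rTensor_lTensor]
  exact Submodule.coe_mem _

theorem weightComp_mem_grading (hH : IsDiagonalizable H) (ρ : Action H 𝒜 d) {n : ℕ} {x : M}
    (hx : x ∈ 𝒜 n) (χ : Character H) : weightComp hH ρ x χ ∈ 𝒜 n :=
  weightComp_mem hH ρ (fun f => Submodule.map_le_iff_le_comap.1 (f.2.1 n).le) hx χ

theorem weightComp_mem_cocycles (hH : IsDiagonalizable H) (ρ : Action H 𝒜 d) {x : M}
    (hx : x ∈ cocycles 𝒜 d) (χ : Character H) : weightComp hH ρ x χ ∈ cocycles 𝒜 d := by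
  refine weightComp_mem hH ρ (fun f => ?_) hx χ
  rw [← cocycles_gradingBC]
  exact dgAut_cocycles f

theorem mul_mem_weightSpace (ρ : Action H 𝒜 d) {x y : M} {χ ψ : Character H}
    (hx : x ∈ weightSpace ρ.onM χ) (hy : y ∈ weightSpace ρ.onM ψ) :
    x * y ∈ weightSpace ρ.onM (χ * ψ) := by
  intro R _ _ g
  have h : (1 : R) ⊗ₜ[ℝ] (x * y) = (1 ⊗ₜ x) * (1 ⊗ₜ y) := by
    rw [Algebra.TensorProduct.tmul_mul_tmul, mul_one]
  have h' : ρ.onM R g ((1 ⊗ₜ x) * (1 ⊗ₜ y)) = ρ.onM R g (1 ⊗ₜ x) * ρ.onM R g (1 ⊗ₜ y) :=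
    map_mul (ρ.hom R g).1 _ _
  rw [h, h', hx R g, hy R g, Algebra.TensorProduct.tmul_mul_tmul, GroupLike.val_mul, map_mul]

theorem one_mem_weightSpace (ρ : Action H 𝒜 d) : (1 : M) ∈ weightSpace ρ.onM 1 := by
  intro R _ _ g
  rw [GroupLike.val_one, map_one]
  exact map_one (ρ.hom R g).1

/-- The subalgebra of the vectors whose weights lie in a submonoid `S` of the character group. -/
noncomputable def weightSubalgebra (hH : IsDiagonalizable H) (ρ : Action H 𝒜 d)
    (S : Submonoid (Character H)) : Subalgebra ℝ M where
  carrier := {x | ∀ χ ∉ S, weightComp hH ρ x χ = 0}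
  add_mem' := by
    intro x y hx hy χ hχ
    rw [map_add, Finsupp.add_apply, hx χ hχ, hy χ hχ, add_zero]
  algebraMap_mem' := by
    intro r χ hχ
    rw [Algebra.algebraMap_eq_smul_one, map_smul, (mem_weightSpace_iff hH ρ 1 1).1
      ρ.one_mem_weightSpace, Finsupp.smul_apply, Finsupp.single_eq_of_ne, smul_zero]
    rintro rfl
    exact hχ S.one_mem
  mul_mem' := by
    intro x y hx hy χ hχ
    -- In the product of the weight decompositions, `x_α y_β` has weight `αβ`. It contributes to `χ
    -- ∉ S` only if `α ∉ S` or `β ∉ S`, and then one factor is zero.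
    rw [← sum_weightComp hH ρ x, ← sum_weightComp hH ρ y, Finsupp.sum, Finsupp.sum,
      Finset.sum_mul_sum, map_sum, Finsupp.finsetSum_apply]
    refine Finset.sum_eq_zero fun α _ => ?_
    rw [map_sum, Finsupp.finsetSum_apply]
    refine Finset.sum_eq_zero fun β _ => ?_
    rw [(mem_weightSpace_iff hH ρ _ _).1 (mul_mem_weightSpace ρ
      (weightComp_mem_weightSpace hH ρ x α) (weightComp_mem_weightSpace hH ρ y β))]
    by_cases hα : α ∈ S
    · by_cases hβ : β ∈ S
      · rw [Finsupp.single_eq_of_ne]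
        rintro rfl
        exact hχ (S.mul_mem hα hβ)
      · rw [hy β hβ, mul_zero, Finsupp.single_zero, Finsupp.zero_apply]
    · rw [hx α hα, zero_mul, Finsupp.single_zero, Finsupp.zero_apply]

/-! ### The action on `P(M)` -/

theorem mk_mem_weightSpace_onPrim (ρ : Action H 𝒜 d) {χ : Character H} (z : cocycles 𝒜 d)
    (hz : (z : M) ∈ weightSpace ρ.onM χ) :
    (Submodule.Quotient.mk z : Prim 𝒜 d) ∈ weightSpace ρ.onPrim χ := by
  intro R _ _ g
  have hmk : ∀ r : R, primBC R 𝒜 d (r ⊗ₜ Submodule.Quotient.mk z) = Submodule.Quotient.mk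
      ⟨r ⊗ₜ (z : M), by
        rw [cocycles_gradingBC]
        exact Submodule.tmul_mem_baseChange_of_mem r z.2⟩ :=
    fun r => primBCMap_mkQ R 𝒜 d (r ⊗ₜ z)
  apply (primBC R 𝒜 d).injective
  rw [hmk]
  refine (primBC_primGL R 𝒜 d (ρ.hom R g) _ _ (hmk 1)).trans ?_
  congr 1
  exact Subtype.ext (hz R g)

theorem mk_eq_sum_weightComp (hH : IsDiagonalizable H) (ρ : Action H 𝒜 d) (z : cocycles 𝒜 d) :
    (Submodule.Quotient.mk z : Prim 𝒜 d) = ∑ χ ∈ (weightComp hH ρ z).support,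
      Submodule.Quotient.mk ⟨weightComp hH ρ z χ, weightComp_mem_cocycles hH ρ z.2 χ⟩ := by
  have h : z = ∑ χ ∈ (weightComp hH ρ z).support,
      ⟨weightComp hH ρ z χ, weightComp_mem_cocycles hH ρ z.2 χ⟩ := by
    apply Subtype.ext
    rw [AddSubmonoidClass.coe_finsetSum]
    exact (sum_weightComp hH ρ (z : M)).symm
  conv_lhs => rw [h]
  exact map_sum (decCocycles 𝒜 d).mkQ _ _

/-- If the class of a cocycle `z` has weight `χ`, independence of weight spaces identifies it with
the class of `z_χ`. So `z_χ` is nonzero when the class is. -/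
theorem weights_onPrim_subset (hH : IsDiagonalizable H) (ρ : Action H 𝒜 d) :
    weights ρ.onPrim ⊆ weights ρ.onM := by
  intro χ hχ
  obtain ⟨t, ht, ht0⟩ := Submodule.exists_mem_ne_zero_of_ne_bot hχ
  obtain ⟨z, rfl⟩ := Submodule.Quotient.mk_surjective _ t
  refine (Submodule.ne_bot_iff _).2 ⟨_, weightComp_mem_weightSpace hH ρ (z : M) χ, fun h => ht0 ?_⟩
  let u : Character H → Prim 𝒜 d := fun χ =>
    Submodule.Quotient.mk ⟨weightComp hH ρ z χ, weightComp_mem_cocycles hH ρ z.2 χ⟩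
  have hu : u χ = 0 := by
    refine (Submodule.Quotient.mk_eq_zero _).2 ?_
    change weightComp hH ρ z χ ∈ decomposables 𝒜
    rw [h]
    exact zero_mem _
  have hsum : Submodule.Quotient.mk z = ∑ ψ ∈ (weightComp hH ρ z).support, u ψ :=
    mk_eq_sum_weightComp hH ρ z
  rw [hsum] at ht ⊢
  exact (eq_of_mem_weightSpace_of_eq_sum hH (fun ψ _ => mk_mem_weightSpace_onPrim ρ _
    (weightComp_mem_weightSpace hH ρ (z : M) ψ)) ht (fun _ => hu)).trans hu

theorem weightComp_mem_decomposables_of_notMem_weights (hH : IsDiagonalizable H)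
    (ρ : Action H 𝒜 d) {z : M} (hz : z ∈ cocycles 𝒜 d) {χ : Character H}
    (hχ : χ ∉ weights ρ.onPrim) : weightComp hH ρ z χ ∈ decomposables 𝒜 := by
  have h := mk_mem_weightSpace_onPrim ρ ⟨_, weightComp_mem_cocycles hH ρ hz χ⟩
    (weightComp_mem_weightSpace hH ρ z χ)
  have h' : weightSpace ρ.onPrim χ = ⊥ := not_not.1 hχ
  rw [h', Submodule.mem_bot, Submodule.Quotient.mk_eq_zero] at h
  exact h

/-- On a nonzero weight vector `t` of `P(M)` the two points give `χ(g) ⊗ t = χ(h) ⊗ t`, and over a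
field `t` can be cancelled. Products of weights follow by multiplicativity. -/
theorem apply_eq_of_toGLPrim_eq (ρ : Action H 𝒜 d) {R : Type v} [CommRing R] [Algebra ℝ R]
    {g h : Points H R} (hgh : ρ.toGLPrim R g = ρ.toGLPrim R h) {χ : Character H}
    (hχ : χ ∈ Submonoid.closure (weights ρ.onPrim)) : g.ofConv χ.val = h.ofConv χ.val := by
  induction hχ using Submonoid.closure_induction with
  | mem χ hχ =>
    obtain ⟨t, ht, ht0⟩ := Submodule.exists_mem_ne_zero_of_ne_bot hχ
    have h1 := ht R g
    unfold onPrim at h1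
    rw [hgh] at h1
    have h2 := h1.symm.trans (ht R h)
    rw [← sub_eq_zero, ← TensorProduct.sub_tmul] at h2
    exact sub_eq_zero.1 ((eq_zero_or_eq_zero_of_tmul h2).resolve_right ht0)
  | one => rw [GroupLike.val_one, map_one, map_one]
  | mul χ ψ _ _ hχ hψ => rw [GroupLike.val_mul, map_mul, map_mul, hχ, hψ]

theorem hom_eq_of_onM_one_tmul_eq {H' : Type v} [CommRing H'] [HopfAlgebra ℝ H']
    {ρ : Action H 𝒜 d} {ρ' : Action H' 𝒜 d} {R : Type v} [CommRing R] [Algebra ℝ R]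
    {g : Points H R} {g' : Points H' R}
    (h : ∀ x : M, ρ.onM R g (1 ⊗ₜ x) = ρ'.onM R g' (1 ⊗ₜ x)) : ρ.hom R g = ρ'.hom R g' := by
  have h2 : ρ.onM R g = ρ'.onM R g' := by
    apply TensorProduct.AlgebraTensorModule.curry_injective
    ext x
    exact h x
  exact Subtype.ext (AlgEquiv.ext fun y => LinearMap.congr_fun h2 y)

theorem hom_eq_of_apply_weights_eq (hH : IsDiagonalizable H) (ρ : Action H 𝒜 d)
    {R : Type v} [CommRing R] [Algebra ℝ R] {g h : Points H R}
    (hgh : ∀ χ ∈ weights ρ.onM, g.ofConv χ.val = h.ofConv χ.val) : ρ.hom R g = ρ.hom R h := by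
  refine hom_eq_of_onM_one_tmul_eq fun x => ?_
  rw [onM_one_tmul_eq_sum hH, onM_one_tmul_eq_sum hH]
  refine Finsupp.sum_congr fun χ hχ => ?_
  rw [hgh χ ((Submodule.ne_bot_iff _).2 ⟨_, weightComp_mem_weightSpace hH ρ x χ,
    Finsupp.mem_support_iff.1 hχ⟩)]

end Action

namespace Action

variable {H : Type v} [CommRing H] [HopfAlgebra ℝ H] {M : Type u} [Ring M] [Algebra ℝ M]
  {𝒜 : ℕ → Submodule ℝ M} {d : M →ₗ[ℝ] M}

/-! ### Faithful actions and inclusions of tori -/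

/-- If the weights generated a proper subgroup, a nontrivial point would take the value `1` on all
of them and act trivially. -/
theorem closure_weights_eq_top (hH : IsDiagonalizable H) (ρ : Action H 𝒜 d) (hρ : ρ.IsFaithful) :
    Subgroup.closure (weights ρ.onM) = ⊤ := by
  by_contra hL
  obtain ⟨R, _, _, g, hg, hgL⟩ := exists_point_ne_one hH _ hL
  refine hg (hρ R ?_)
  refine hom_eq_of_apply_weights_eq hH ρ fun χ hχ => ?_
  rw [one_apply_character]
  exact hgL χ (Subgroup.subset_closure hχ)

/-- The generic point of `T`, seen as a point of a larger group `T'`, determines the inclusion. -/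
theorem hom_eq_hom_comp {H' : Type v} [CommRing H'] [HopfAlgebra ℝ H'] {ρ : Action H 𝒜 d}
    {ρ' : Action H' 𝒜 d} {f : H' →ₐ[ℝ] H}
    (hf : ρ'.hom H (WithConv.toConv f) = ρ.hom H (WithConv.toConv (AlgHom.id ℝ H)))
    (R : Type v) [CommRing R] [Algebra ℝ R] (g : Points H R) :
    ρ.hom R g = ρ'.hom R (WithConv.toConv (g.ofConv.comp f)) := by
  refine hom_eq_of_onM_one_tmul_eq fun x => ?_
  have h := ρ'.natural H R g.ofConv (WithConv.toConv f) (1 ⊗ₜ x)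
  rw [LinearMap.rTensor_tmul, AlgHom.toLinearMap_apply, map_one, hf] at h
  rw [onM_one_tmul]
  exact h.symm

/-- `f` is only an algebra homomorphism. Faithfulness of `ρ'` forces the induced map `T → T'` to
respect the identity and the product of the two coordinate points of `T × T`, which gives the counit
and comultiplication conditions. -/
theorem isGroupLikeElem_of_hom_eq {H' : Type v} [CommRing H'] [HopfAlgebra ℝ H']
    {ρ : Action H 𝒜 d} {ρ' : Action H' 𝒜 d} (hρ' : ρ'.IsFaithful) {f : H' →ₐ[ℝ] H}
    (hf : ρ'.hom H (WithConv.toConv f) = ρ.hom H (WithConv.toConv (AlgHom.id ℝ H)))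
    (χ : Character H') : IsGroupLikeElem ℝ (f χ.val) := by
  constructor
  · have h : WithConv.toConv ((1 : Points H H).ofConv.comp f) = (1 : Points H' H) := by
      apply hρ' H
      rw [← hom_eq_hom_comp hf, map_one, map_one]
    have h1 := one_apply_character (R := H) χ
    rw [← h] at h1
    have h2 : algebraMap ℝ H (Coalgebra.counit (R := ℝ) (f χ.val)) = 1 := h1
    have := hopfAlgebra_nontrivial H
    exact (algebraMap ℝ H).injective (h2.trans (map_one _).symm)
  · let i₁ : Points H (H ⊗[ℝ] H) := WithConv.toConv Algebra.TensorProduct.includeLeft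
    let i₂ : Points H (H ⊗[ℝ] H) := WithConv.toConv Algebra.TensorProduct.includeRight
    have h : WithConv.toConv ((i₁ * i₂).ofConv.comp f) =
        (WithConv.toConv (i₁.ofConv.comp f) * WithConv.toConv (i₂.ofConv.comp f) :
          Points H' (H ⊗[ℝ] H)) := by
      apply hρ'
      rw [map_mul, ← hom_eq_hom_comp hf, ← hom_eq_hom_comp hf, ← hom_eq_hom_comp hf, map_mul]
    have h1 := mul_apply_character (WithConv.toConv (i₁.ofConv.comp f))
      (WithConv.toConv (i₂.ofConv.comp f)) χ
    rw [← h, includeLeft_mul_includeRight] at h1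
    have h2 : Coalgebra.comul (R := ℝ) (f χ.val) = (f χ.val ⊗ₜ[ℝ] 1) * (1 ⊗ₜ[ℝ] f χ.val) := h1
    rw [h2, Algebra.TensorProduct.tmul_mul_tmul, mul_one, one_mul]

/-- The map on characters that an inclusion `T ⊆ T'` of subgroups of `Aut M` induces. -/
theorem exists_characterMap {H' : Type v} [CommRing H'] [HopfAlgebra ℝ H']
    (hH : IsDiagonalizable H) (hH' : IsDiagonalizable H')
    {ρ : Action H 𝒜 d} {ρ' : Action H' 𝒜 d} (hρ : ρ.IsFaithful) (hρ' : ρ'.IsFaithful)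
    {f : H' →ₐ[ℝ] H}
    (hf : ρ'.hom H (WithConv.toConv f) = ρ.hom H (WithConv.toConv (AlgHom.id ℝ H))) :
    ∃ φ : Character H' →* Character H, Function.Surjective φ ∧ ∀ χ, (φ χ).val = f χ.val := by
  let φ : Character H' →* Character H :=
    { toFun := fun χ => ⟨f χ.val, isGroupLikeElem_of_hom_eq hρ' hf χ⟩
      map_one' := GroupLike.val_injective (map_one f)
      map_mul' := fun χ ψ => GroupLike.val_injective (map_mul f χ.val ψ.val) }
  refine ⟨φ, ?_, fun _ => rfl⟩
  rw [← MonoidHom.range_eq_top]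
  -- Otherwise a nontrivial point of `T` is killed by all characters restricted from `T'`. Its image
  -- in `T'` is then trivial, contradicting faithfulness of `ρ`.
  by_contra hL
  obtain ⟨R, _, _, g, hg, hgL⟩ := exists_point_ne_one hH _ hL
  refine hg (hρ R ?_)
  have h : WithConv.toConv (g.ofConv.comp f) = (1 : Points H' R) := by
    apply WithConv.ofConv_injective
    refine algHom_ext_of_character hH' fun χ => ?_
    rw [one_apply_character]
    exact hgL (φ χ) ⟨χ, rfl⟩
  rw [hom_eq_hom_comp hf, h, map_one, map_one]

theorem isContainedIn_of_bijective {H' : Type v} [CommRing H'] [HopfAlgebra ℝ H']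
    {ρ : Action H 𝒜 d} {ρ' : Action H' 𝒜 d} {f : H' →ₐ[ℝ] H} (hbij : Function.Bijective f)
    (hf : ρ'.hom H (WithConv.toConv f) = ρ.hom H (WithConv.toConv (AlgHom.id ℝ H))) :
    ρ'.IsContainedIn ρ := by
  rintro R _ _ _ ⟨h, rfl⟩
  let e := AlgEquiv.ofBijective f hbij
  refine ⟨WithConv.toConv (h.ofConv.comp e.symm.toAlgHom), ?_⟩
  rw [hom_eq_hom_comp hf]
  congr 1
  apply WithConv.ofConv_injective
  ext x
  exact congrArg h.ofConv (e.symm_apply_apply x)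

end Action

/-! ### Character lattices and their ranks -/

theorem bijective_of_characterMap {H H' : Type v} [CommRing H] [HopfAlgebra ℝ H] [CommRing H']
    [HopfAlgebra ℝ H'] (hH : IsDiagonalizable H) (hH' : IsDiagonalizable H') {f : H' →ₐ[ℝ] H}
    {φ : Character H' → Character H} (hφ : Function.Bijective φ)
    (hf : ∀ χ, (φ χ).val = f χ.val) : Function.Bijective f := by
  let E := (charBasis hH').equiv (charBasis hH) (Equiv.ofBijective φ hφ)
  have h : f.toLinearMap = E.toLinearMap := by
    refine (charBasis hH').ext fun χ => ?_
    rw [LinearEquiv.coe_coe, Module.Basis.equiv_apply, charBasis_apply, charBasis_apply,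
      Equiv.ofBijective_apply, hf]
    rfl
  exact (congrArg (fun F : H' →ₗ[ℝ] H => Function.Bijective F) h).mpr E.bijective

theorem IsSplitTorus.le_ncard {H : Type v} [CommRing H] [HopfAlgebra ℝ H] {n : ℕ}
    (h : IsSplitTorus H n) {s : Set (Character H)} (hs : s.Finite)
    (hcl : Subgroup.closure s = ⊤) : n ≤ s.ncard := by
  classical
  obtain ⟨e⟩ := h.character_equiv
  let F : Character H → (Fin n → ℤ) := fun χ => (e.symm χ).toAdd
  have hspan : Submodule.span ℤ ((hs.toFinset.image F : Finset (Fin n → ℤ)) : Set (Fin n → ℤ)) =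
      ⊤ := by
    rw [Submodule.eq_top_iff']
    intro m
    have hm : ∀ χ ∈ Subgroup.closure s, F χ ∈
        Submodule.span ℤ ((hs.toFinset.image F : Finset (Fin n → ℤ)) : Set (Fin n → ℤ)) := by
      intro χ hχ
      induction hχ using Subgroup.closure_induction with
      | mem χ hχ =>
        exact Submodule.subset_span (Finset.mem_coe.2 (Finset.mem_image_of_mem F
          (hs.mem_toFinset.2 hχ)))
      | one =>
        have : F 1 = 0 := by simp only [F, map_one, toAdd_one]
        rw [this]
        exact zero_mem _
      | mul χ ψ _ _ hχ hψ =>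
        have : F (χ * ψ) = F χ + F ψ := by simp only [F, map_mul, toAdd_mul]
        rw [this]
        exact add_mem hχ hψ
      | inv χ _ hχ =>
        have : F χ⁻¹ = -F χ := by simp only [F, map_inv, toAdd_inv]
        rw [this]
        exact neg_mem hχ
    have := hm (e (Multiplicative.ofAdd m)) (hcl ▸ Subgroup.mem_top _)
    simpa only [F, MulEquiv.symm_apply_apply, toAdd_ofAdd] using this
  have h1 := finrank_span_finset_le_card (R := ℤ) (hs.toFinset.image F)
  rw [Set.finrank, hspan, finrank_top, Module.finrank_fin_fun] at h1
  refine h1.trans (Finset.card_image_le.trans ?_)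
  rw [Set.ncard_eq_toFinset_card s hs]

/-- A surjection `ℤ^{n'} → ℤⁿ` forces `n ≤ n'`, so the ranks agree, and a surjective endomorphism of
a finitely generated module is injective. -/
theorem IsSplitTorus.bijective_of_surjective {H H' : Type v} [CommRing H] [HopfAlgebra ℝ H]
    [CommRing H'] [HopfAlgebra ℝ H'] {n n' : ℕ} (h : IsSplitTorus H n) (h' : IsSplitTorus H' n')
    (hn : n' ≤ n) {φ : Character H' →* Character H} (hφ : Function.Surjective φ) :
    Function.Bijective φ := by
  obtain ⟨e⟩ := h.character_equiv
  obtain ⟨e'⟩ := h'.character_equiv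
  let F : (Fin n' → ℤ) →ₗ[ℤ] (Fin n → ℤ) :=
    (MonoidHom.toAdditive ((e.symm.toMonoidHom.comp φ).comp e'.toMonoidHom)).toIntLinearMap
  have hF : Function.Surjective F := (e.symm.surjective.comp hφ).comp e'.surjective
  have hnn : n = n' := le_antisymm (le_of_fin_surjective ℤ F hF) hn
  subst hnn
  have hinj : Function.Injective F := OrzechProperty.injective_of_surjective_endomorphism F hF
  refine ⟨fun χ ψ hχψ => ?_, hφ⟩
  obtain ⟨a, rfl⟩ := e'.surjective χ
  obtain ⟨b, rfl⟩ := e'.surjective ψ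
  have : a = b := hinj (congrArg e.symm hχψ)
  rw [this]

/-! ### Split tori of a minimal Sullivan algebra -/

section Sullivan

variable {V : Type u} [AddCommGroup V] [Module ℝ V] {𝒱 : ℕ → Submodule ℝ V}
  {d : FreeGCA 𝒱 →ₗ[ℝ] FreeGCA 𝒱} {H : Type v} [CommRing H] [HopfAlgebra ℝ H]

theorem weightSubalgebra_eq_top (hS : IsSullivan 𝒱 d) (hmin : IsMinimal 𝒱 d)
    (hH : IsDiagonalizable H) (ρ : Action H (grading 𝒱) d) :
    Action.weightSubalgebra hH ρ (Submonoid.closure (weights ρ.onPrim)) = ⊤ := by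
  refine eq_top_of_gen_mem hS hmin _ fun n ih v hv hdv χ hχ => ?_
  let y := Action.weightComp hH ρ (gen 𝒱 v) χ
  rcases Nat.eq_zero_or_pos n with rfl | hn
  · rw [hS.positive, Submodule.mem_bot] at hv
    rw [hv, map_zero, map_zero, Finsupp.zero_apply]
  have hyn : y ∈ grading 𝒱 n := Action.weightComp_mem_grading hH ρ (gen_mem_grading hv) χ
  have hyc : y ∈ cocycles (grading 𝒱) d := by
    refine ⟨?_, grading_le_augIdeal hn hyn⟩
    -- `dy` is the `χ`-component of `dv ∈ A`, which vanishes because `χ ∉ S`.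
    change d y = 0
    rw [← Action.weightComp_d]
    exact hdv χ hχ
  have hyy : Action.weightComp hH ρ y χ = y := by
    rw [(Action.mem_weightSpace_iff hH ρ y χ).1 (Action.weightComp_mem_weightSpace hH ρ _ χ),
      Finsupp.single_eq_same]
  have hyd := Action.weightComp_mem_decomposables_of_notMem_weights hH ρ hyc
    (fun h => hχ (Submonoid.subset_closure h))
  rw [hyy] at hyd
  -- Being decomposable of degree `n`, `y` lies in `A`; so its `χ`-component, which is `y` itself,
  -- is zero.
  exact hyy.symm.trans (mem_of_decomposable hS.isInternal ih hyn hyd χ hχ)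

theorem weights_onM_subset (hS : IsSullivan 𝒱 d) (hmin : IsMinimal 𝒱 d)
    (hH : IsDiagonalizable H) (ρ : Action H (grading 𝒱) d) :
    weights ρ.onM ⊆ Submonoid.closure (weights ρ.onPrim) := by
  intro χ hχ
  by_contra h
  obtain ⟨w, hw, hw0⟩ := Submodule.exists_mem_ne_zero_of_ne_bot hχ
  have hwA : w ∈ Action.weightSubalgebra hH ρ (Submonoid.closure (weights ρ.onPrim)) := by
    rw [weightSubalgebra_eq_top hS hmin hH ρ]
    exact Algebra.mem_top
  have := hwA χ h
  rw [(Action.mem_weightSpace_iff hH ρ w χ).1 hw, Finsupp.single_eq_same] at this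
  exact hw0 this

theorem hom_eq_of_toGLPrim_eq (hS : IsSullivan 𝒱 d) (hmin : IsMinimal 𝒱 d)
    (hH : IsDiagonalizable H) (ρ : Action H (grading 𝒱) d) {R : Type v} [CommRing R] [Algebra ℝ R]
    {g h : Points H R} (hgh : ρ.toGLPrim R g = ρ.toGLPrim R h) : ρ.hom R g = ρ.hom R h :=
  Action.hom_eq_of_apply_weights_eq hH ρ fun _ hχ =>
    Action.apply_eq_of_toGLPrim_eq ρ hgh (weights_onM_subset hS hmin hH ρ hχ)

theorem dim_le_finrank_prim [FiniteDimensional ℝ V] (hS : IsSullivan 𝒱 d) (hmin : IsMinimal 𝒱 d)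
    {n : ℕ} (hT : IsSplitTorus H n) (ρ : Action H (grading 𝒱) d) (hρ : ρ.IsFaithful) :
    n ≤ Module.finrank ℝ (Prim (grading 𝒱) d) := by
  have hH := hT.isDiagonalizable
  have := finiteDimensional_prim hS
  obtain ⟨hfin, hcard⟩ := card_weights_le (ρ := ρ.onPrim) hH
  refine (hT.le_ncard hfin (top_le_iff.1 ?_)).trans hcard
  rw [← Action.closure_weights_eq_top hH ρ hρ, Subgroup.closure_le]
  exact (weights_onM_subset hS hmin hH ρ).trans (Subgroup.le_closure_toSubmonoid _)

theorem isMaximalSplitTorus [FiniteDimensional ℝ V] (hS : IsSullivan 𝒱 d) (hmin : IsMinimal 𝒱 d)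
    {n : ℕ} (hT : IsSplitTorus H n) (ρ : Action H (grading 𝒱) d) (hρ : ρ.IsFaithful)
    (hn : n = Module.finrank ℝ (Prim (grading 𝒱) d)) : ρ.IsMaximalSplitTorus := by
  refine ⟨⟨n, hT⟩, hρ, fun H' _ _ n' hT' ρ' hρ' hsub => ?_⟩
  -- The generic point of `T`, seen as an `H`-point of `T'`, is the homomorphism of coordinate rings
  -- of the inclusion.
  obtain ⟨f, hf⟩ := hsub H ⟨WithConv.toConv (AlgHom.id ℝ H), rfl⟩
  have hf' : ρ'.hom H (WithConv.toConv f.ofConv) = ρ.hom H (WithConv.toConv (AlgHom.id ℝ H)) := hf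
  obtain ⟨φ, hφ, hφf⟩ := Action.exists_characterMap hT.isDiagonalizable hT'.isDiagonalizable
    hρ hρ' hf'
  -- The dimension bound, applied to the larger torus `T'`, supplies `n' ≤ dim P(M) = n`.
  exact Action.isContainedIn_of_bijective (bijective_of_characterMap hT.isDiagonalizable
    hT'.isDiagonalizable (hT.bijective_of_surjective hT'
      (hn ▸ dim_le_finrank_prim hS hmin hT' ρ' hρ') hφ) hφf) hf'

end Sullivan

end SplitTori

theorem mainTheorem7 {V : Type u} [AddCommGroup V] [Module ℝ V] [FiniteDimensional ℝ V]
    (𝒱 : ℕ → Submodule ℝ V) (d : SplitTori.FreeGCA 𝒱 →ₗ[ℝ] SplitTori.FreeGCA 𝒱)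
    (hS : SplitTori.IsSullivan 𝒱 d) (hmin : SplitTori.IsMinimal 𝒱 d) :
    (∀ (H : Type v) [CommRing H] [HopfAlgebra ℝ H] (n : ℕ), SplitTori.IsSplitTorus H n →
      ∀ ρ : SplitTori.Action H (SplitTori.grading 𝒱) d,
        -- the weights of `M` are products of weights of `P(M)`, which are weights of `M`
        (SplitTori.weights ρ.onPrim ⊆ SplitTori.weights ρ.onM ∧
          SplitTori.weights ρ.onM ⊆ Submonoid.closure (SplitTori.weights ρ.onPrim)) ∧
        -- whatever acts trivially on `P(M)` acts trivially on `M`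
        (∀ (R : Type v) [CommRing R] [Algebra ℝ R] (g : SplitTori.Points H R),
          ρ.toGLPrim R g = 1 → ρ.hom R g = 1) ∧
        -- if `T ⊆ Aut M`, then `T → GL(P(M))` is injective and `dim T ≤ dim P(M)`
        (ρ.IsFaithful →
          (∀ (R : Type v) [CommRing R] [Algebra ℝ R], Function.Injective (ρ.toGLPrim R)) ∧
          FiniteDimensional ℝ (SplitTori.Prim (SplitTori.grading 𝒱) d) ∧
          n ≤ Module.finrank ℝ (SplitTori.Prim (SplitTori.grading 𝒱) d)) ∧
        -- if `T ⊆ Aut M` and `dim T = dim P(M)`, then `T` is a maximal split torus of `Aut M`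
        (ρ.IsFaithful → n = Module.finrank ℝ (SplitTori.Prim (SplitTori.grading 𝒱) d) →
          ρ.IsMaximalSplitTorus)) ∧
    -- if `d` is quadratic, then `ker d ∩ V = Z(M⁺) ∩ V → P(M)` is an isomorphism
    (SplitTori.IsQuadratic 𝒱 d →
      LinearMap.ker d ⊓ SplitTori.genSpace 𝒱 =
        SplitTori.cocycles (SplitTori.grading 𝒱) d ⊓ SplitTori.genSpace 𝒱 ∧
      Function.Bijective (SplitTori.genToPrim 𝒱 d)) := by
  refine ⟨fun H _ _ n hT ρ => ?_, fun hq =>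
    ⟨SplitTori.ker_inf_genSpace hS, SplitTori.genToPrim_bijective hS hmin hq⟩⟩
  have hH := hT.isDiagonalizable
  refine ⟨⟨SplitTori.Action.weights_onPrim_subset hH ρ,
    SplitTori.weights_onM_subset hS hmin hH ρ⟩,
    fun R _ _ g hg => (SplitTori.hom_eq_of_toGLPrim_eq hS hmin hH ρ
      (hg.trans (map_one _).symm)).trans (map_one _),
    fun hρ => ⟨fun R _ _ _ _ h => hρ R (SplitTori.hom_eq_of_toGLPrim_eq hS hmin hH ρ h),
      SplitTori.finiteDimensional_prim hS, SplitTori.dim_le_finrank_prim hS hmin hT ρ hρ⟩,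
    fun hρ hn => SplitTori.isMaximalSplitTorus hS hmin hT ρ hρ hn⟩
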